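/- Let $C_4\subset\mathbb P^2$ be the smooth plane quartic $X^4+Y^4+Z^4=0$ over $\mathbb Q$, let $\zeta_8$ be a primitive 8th root of unity, and let $$E = 2\,[1:0:\zeta_8^3]-2\,[1:0:\zeta_8^7],$$ a divisor on $C_4$ defined over $\mathbb Q(\zeta_8)$. (1) The divisor $E$ has degree $0$, and its class $[E]\in \mathrm{Jac}(C_4)(\mathbb Q(\zeta_8))=\mathrm{Pic}^0(C_4\otimes\mathbb Q(\zeta_8))$ is invariant under $\mathrm{Gal}(\mathbb Q(\zeta_8)/\mathbb Q)$. (2) $E$ is not linearly equivalent to a divisor defined over $\mathbb Q$: for every Galois extension $M/\mathbb Q$ containing $\zeta_8$ (for instance $M=\mathbb Q(\zeta_8)$ or $M=\overline{\mathbb Q}$), $E$ is not linearly equivalent on $C_4\otimes M$ to a $\mathrm{Gal}(M/\mathbb Q)$-invariant divisor. In other words, the image of $[E]$ in the relative Brauer group $\mathrm{Br}(C_4/\mathbb Q)=\ker(\mathrm{Br}(\mathbb Q)\to\mathrm{Br}(C_4))$ is non-trivial. Here the image of $[E]$ is the class in $\mathrm{Br}(\mathbb Q)$ of the 2-cocycle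 $a_{\sigma,\tau}=u_\sigma\,\sigma(u_\tau)/u_{\sigma\tau}\in\mathbb Q(\zeta_8)^\times$ of $\mathrm{Gal}(\mathbb Q(\zeta_8)/\mathbb Q)$, where $D$ is a divisor on $C_4\otimes\mathbb Q(\zeta_8)$ in the class $[E]$ and the $u_\sigma$ are rational functions with $\mathrm{div}(u_\sigma)=D-\sigma(D)$; such functions exist, the class does not depend on the choices, and it lies in $\mathrm{Br}(C_4/\mathbb Q)$. Moreover, the image of this class in $\mathrm{Br}(\mathbb R)\cong\{\pm1\}$ is the non-trivial class, that of Hamilton's quaternion algebra $\mathbb H$. -/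

import Mathlib

open Polynomial
open scoped Quaternion TensorProduct

noncomputable section

namespace FermatTwist

/-! ### The curve `C₄ : X⁴ + Y⁴ + Z⁴ = 0` over a field `K` of characteristic zero -/

/-- The dehomogenized equation `y⁴ + (x⁴ + 1)` of `C₄` on the chart `Z ≠ 0`, as a polynomial in `y`
over `K[x]`. -/
def affineEq (K : Type*) [Field K] : K[X][X] := X ^ 4 + C (X ^ 4 + 1)

lemma affineEq_natDegree (K : Type*) [Field K] : (affineEq K).natDegree = 4 := by
  unfold affineEq; exact natDegree_X_pow_add_C

lemma affineEq_monic (K : Type*) [Field K] : (affineEq K).Monic :=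
  monic_X_pow_add_C _ (by norm_num)

theorem affineEq_irreducible (K : Type*) [Field K] [CharZero K] : Irreducible (affineEq K) := by
  have hdeg : (X ^ 4 + 1 : K[X]).natDegree = 4 := by
    have := natDegree_X_pow_add_C (R := K) (n := 4) (r := 1)
    simpa using this
  have h0 : (X ^ 4 + 1 : K[X]) ≠ 0 := by
    intro h; rw [h] at hdeg; simp at hdeg
  have hu : ¬ IsUnit (X ^ 4 + 1 : K[X]) := by
    intro h; have := natDegree_eq_zero_of_isUnit h; omega
  obtain ⟨p, hp, hpd⟩ := WfDvdMonoid.exists_irreducible_factor hu h0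
  have hsep : (X ^ 4 + 1 : K[X]).Separable := by
    refine ⟨1, C (-(1/4)) * X, ?_⟩
    have h4 : (C (-(1/4) : K)) * 4 = -1 := by
      have : (4 : K[X]) = C 4 := (map_ofNat C 4).symm
      rw [this, ← C_mul]; norm_num
    have hd : derivative (X ^ 4 + 1 : K[X]) = 4 * X ^ 3 := by
      rw [derivative_add, derivative_X_pow, derivative_one, add_zero]
      simp only [Nat.cast_ofNat, map_ofNat]
    rw [hd]
    linear_combination (X ^ 4 : K[X]) * h4
  have hsq : ¬ p * p ∣ (X ^ 4 + 1 : K[X]) := fun h => hp.not_isUnit (hsep.squarefree p h)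
  have hpP : Prime p := hp.prime
  have hP : (Ideal.span {p}).IsPrime := (Ideal.span_singleton_prime hpP.ne_zero).2 hpP
  refine irreducible_of_eisenstein_criterion hP ?_ ?_ ?_ ?_ (affineEq_monic K).isPrimitive
  · rw [(affineEq_monic K).leadingCoeff]
    exact fun h => hP.ne_top ((Ideal.eq_top_iff_one _).2 h)
  · intro n hn
    rw [degree_eq_natDegree (affineEq_monic K).ne_zero, affineEq_natDegree] at hn
    have hn : n < 4 := by exact_mod_cast hn
    rw [Ideal.mem_span_singleton]
    unfold affineEq
    rw [coeff_add, coeff_X_pow, if_neg (by omega), zero_add, coeff_C]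
    split_ifs
    · exact hpd
    · exact dvd_zero _
  · rw [degree_eq_natDegree (affineEq_monic K).ne_zero, affineEq_natDegree]
    norm_num
  · rw [pow_two, Ideal.span_singleton_mul_span_singleton, Ideal.mem_span_singleton]
    have h : (affineEq K).coeff 0 = X ^ 4 + 1 := by
      unfold affineEq
      rw [coeff_add, coeff_X_pow, if_neg (by norm_num), zero_add, coeff_C_zero]
    rw [h]
    exact hsq

/-- The affine coordinate ring `K[x, y] / (x⁴ + y⁴ + 1)`. -/
abbrev CoordRing (K : Type*) [Field K] : Type _ := AdjoinRoot (affineEq K)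

instance (K : Type*) [Field K] [CharZero K] : IsDomain (CoordRing K) :=
  AdjoinRoot.isDomain_of_prime (affineEq_irreducible K).prime

/-- The function field `K(C₄)`. -/
abbrev FunField (K : Type*) [Field K] [CharZero K] : Type _ := FractionRing (CoordRing K)

/-- The homogeneous coordinates `[X : Y : Z] = [x : y : 1]` of the generic point of `C₄`. -/
def coord (K : Type*) [Field K] [CharZero K] : Fin 3 → FunField K :=
  ![algebraMap (CoordRing K) (FunField K) (AdjoinRoot.of (affineEq K) X),
    algebraMap (CoordRing K) (FunField K) (AdjoinRoot.root (affineEq K)),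
    1]

/-- The closed points of the smooth projective curve `C₄` over `K`: the discrete valuation rings
`v` with `K ⊆ v ⊆ K(C₄)` and fraction field `K(C₄)` (these are the local rings of the curve at its
closed points). -/
def Place (K : Type*) [Field K] [CharZero K] : Type _ :=
  {v : ValuationSubring (FunField K) //
    (∀ c : K, algebraMap K (FunField K) c ∈ v) ∧ IsDiscreteValuationRing v}

section Curve

variable {K : Type*} [Field K] [CharZero K]

instance (v : Place K) : IsDiscreteValuationRing v.1 := v.2.2

/-- The order of vanishing of `f` at the closed point `v` (only meaningful for `f ≠ 0`). -/
def ord (v : Place K) (f : FunField K) : ℤ :=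
  -WithZero.log ((IsDiscreteValuationRing.maximalIdeal v.1).valuation (FunField K) f)

lemma ord_mul (v : Place K) {f g : FunField K} (hf : f ≠ 0) (hg : g ≠ 0) :
    ord v (f * g) = ord v f + ord v g := by
  unfold ord
  rw [map_mul, WithZero.log_mul (by simpa using hf) (by simpa using hg)]
  ring

lemma ord_one (v : Place K) : ord v (1 : FunField K) = 0 := by
  simp [ord]

/-- The constants `K`, as a subring of the local ring `v`. -/
def constHom (v : Place K) : K →+* v.1 :=
  (algebraMap K (FunField K)).codRestrict v.1.toSubring v.2.1

/-- The degree over `K` of the residue field of a closed point. -/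
def placeDegree (v : Place K) : ℕ :=
  letI : Algebra K (IsLocalRing.ResidueField v.1) :=
    ((IsLocalRing.residue v.1).comp (constHom v)).toAlgebra
  Module.finrank K (IsLocalRing.ResidueField v.1)

end Curve

/-- Divisors on `C₄` over `K`. -/
abbrev Divisor (K : Type*) [Field K] [CharZero K] : Type _ := Place K →₀ ℤ

/-- `D = div f`, for a nonzero rational function `f`. -/
def IsDiv {K : Type*} [Field K] [CharZero K] (f : FunField K) (D : Divisor K) : Prop :=
  f ≠ 0 ∧ ∀ v, D v = ord v f

/-- The subgroup of principal divisors. -/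
def principal (K : Type*) [Field K] [CharZero K] : AddSubgroup (Divisor K) where
  carrier := {D | ∃ f, IsDiv f D}
  zero_mem' := ⟨1, one_ne_zero, fun v => (ord_one v).symm⟩
  add_mem' := by
    rintro D D' ⟨f, hf, h⟩ ⟨g, hg, h'⟩
    refine ⟨f * g, mul_ne_zero hf hg, fun v => ?_⟩
    rw [ord_mul v hf hg, Finsupp.add_apply, h, h']
  neg_mem' := by
    rintro D ⟨f, hf, h⟩
    refine ⟨f⁻¹, inv_ne_zero hf, fun v => ?_⟩
    have := ord_mul v hf (inv_ne_zero hf)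
    rw [mul_inv_cancel₀ hf, ord_one] at this
    rw [Finsupp.neg_apply, h]
    omega

/-- The Picard group of `C₄` over `K`: divisors modulo linear equivalence. -/
abbrev Pic (K : Type*) [Field K] [CharZero K] : Type _ := Divisor K ⧸ principal K

/-- The class `[D]` of a divisor. -/
def cls {K : Type*} [Field K] [CharZero K] (D : Divisor K) : Pic K :=
  QuotientAddGroup.mk' (principal K) D

/-- The degree of a divisor. -/
def degree (K : Type*) [Field K] [CharZero K] : Divisor K →+ ℤ :=
  Finsupp.liftAddHom fun v => (placeDegree v : ℤ) • AddMonoidHom.id ℤ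

/-- The group of classes of divisors of degree zero. It is `Jac(C₄)(K)` as soon as `C₄` has a
`K`-rational point, in particular for `K = ℚ(ζ₈)`. -/
def Pic0 (K : Type*) [Field K] [CharZero K] : AddSubgroup (Pic K) :=
  (degree K).ker.map (QuotientAddGroup.mk' (principal K))

/-! ### Rational points -/

section Points

variable {K : Type*} [Field K] [CharZero K]

/-- The closed point `v` is the `K`-rational point `[a₀ : a₁ : a₂]` of the projective plane.
With homogeneous coordinates `X₀, X₁, X₂` scaled so that the largest of their values at `v` is `1`,
this says that the reduction of `(X₀, X₁, X₂)` is proportional to `(a₀, a₁, a₂)`. -/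
def HasCenter (v : Place K) (a : Fin 3 → K) : Prop :=
  a ≠ 0 ∧ ∀ i j, ∃ k, v.1.valuation (algebraMap K (FunField K) (a i) * coord K j
    - algebraMap K (FunField K) (a j) * coord K i) < v.1.valuation (coord K k)

/-- The `K`-rational point `[a₀ : a₁ : a₂]` of `C₄` as a divisor. (As `C₄` is smooth,
exactly one closed point has a given rational point of `C₄` as its center.) -/
def point (a : Fin 3 → K) : Divisor K :=
  ∑ᶠ v : {v : Place K // HasCenter v a}, Finsupp.single v.1 1

/-- The divisor `E = 2 [1 : 0 : ζ³] - 2 [1 : 0 : ζ⁷]`, where `ζ` is a primitive 8th root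
of unity. -/
def divE (ζ : K) : Divisor K :=
  (2 : ℤ) • point ![1, 0, ζ ^ 3] - (2 : ℤ) • point ![1, 0, ζ ^ 7]

end Points

/-! ### Galois action -/

section Galois

lemma comap_symm_isDVR {F F' : Type*} [Field F] [Field F'] (e : F ≃+* F')
    (v : ValuationSubring F) (hv : IsDiscreteValuationRing v) :
    IsDiscreteValuationRing (v.comap e.symm.toRingHom) :=
  IsDiscreteValuationRing.RingEquivClass.isDiscreteValuationRing
    ({  toFun := fun f => ⟨e f.1, by simp⟩
        invFun := fun f => ⟨e.symm f.1, f.2⟩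
        left_inv := fun f => Subtype.ext (by simp)
        right_inv := fun f => Subtype.ext (by simp)
        map_mul' := fun f g => Subtype.ext (map_mul e f.1 g.1)
        map_add' := fun f g => Subtype.ext (map_add e f.1 g.1) } :
      v ≃+* v.comap e.symm.toRingHom)

variable {K : Type*} [Field K] [CharZero K] [Algebra ℚ K]

/-- The action of an automorphism of `K` on `K[x, y] / (x⁴ + y⁴ + 1)`, fixing `x` and `y`. -/
def galCoordRing (σ : K ≃ₐ[ℚ] K) : CoordRing K ≃+* CoordRing K :=
  AdjoinRoot.mapRingEquiv (Polynomial.mapEquiv σ.toRingEquiv) (affineEq K) (affineEq K)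
    (by simp [affineEq])

/-- The action of an automorphism of `K` on `K(C₄)`, fixing `x` and `y`. -/
def galFun (σ : K ≃ₐ[ℚ] K) : FunField K ≃+* FunField K :=
  IsFractionRing.ringEquivOfRingEquiv (galCoordRing σ)

lemma galFun_const (σ : K ≃ₐ[ℚ] K) (c : K) :
    galFun σ (algebraMap K (FunField K) c) = algebraMap K (FunField K) (σ c) := by
  rw [IsScalarTower.algebraMap_apply K (CoordRing K) (FunField K), galFun,
    IsFractionRing.ringEquivOfRingEquiv_algebraMap,
    IsScalarTower.algebraMap_apply K (CoordRing K) (FunField K)]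
  congr 1
  simp [galCoordRing, AdjoinRoot.algebraMap_eq', Polynomial.algebraMap_eq]

lemma galFun_symm_const (σ : K ≃ₐ[ℚ] K) (c : K) :
    (galFun σ).symm (algebraMap K (FunField K) c) = algebraMap K (FunField K) (σ.symm c) := by
  rw [RingEquiv.symm_apply_eq, galFun_const, AlgEquiv.apply_symm_apply]

/-- The local ring `σ v = {σ f | f ∈ v}`. If `v` is the point `[a : b : c]`, then `σ v` is
`[σ a : σ b : σ c]`. -/
def galPlace (σ : K ≃ₐ[ℚ] K) (v : Place K) : Place K :=
  ⟨v.1.comap (galFun σ).symm.toRingHom, fun c => by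
      rw [ValuationSubring.mem_comap, RingEquiv.toRingHom_eq_coe, RingHom.coe_coe,
        galFun_symm_const]
      exact v.2.1 _,
    comap_symm_isDVR (galFun σ) v.1 v.2.2⟩

/-- The action of an automorphism of `K` on divisors. -/
def galDiv (σ : K ≃ₐ[ℚ] K) : Divisor K →+ Divisor K := Finsupp.mapDomain.addMonoidHom (galPlace σ)

/-- For `K / ℚ` Galois: the divisor `D` is defined over `ℚ`, i.e. it is Galois invariant. -/
def DefinedOverRat (D : Divisor K) : Prop := ∀ σ : K ≃ₐ[ℚ] K, galDiv σ D = D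

end Galois

/-! ### Brauer groups -/

section Brauer

/-- The neutral element of the Brauer group: the class of the field `K` itself. -/
def brauerOne (K : Type) [Field K] : BrauerGroup.{0, 0} K :=
  Quotient.mk (Brauer.CSA_Setoid K) { AlgCat.of K K with }

/-- `γ` is the image of `β` under `Br(K) → Br(K')`, `[A] ↦ [K' ⊗ A]`. -/
def BaseChangesTo {K K' : Type} [Field K] [Field K'] [Algebra K K']
    (β : BrauerGroup.{0, 0} K) (γ : BrauerGroup.{0, 0} K') : Prop :=
  ∃ (A : CSA.{0, 0} K) (B : CSA.{0, 0} K'),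
    Quotient.mk (Brauer.CSA_Setoid K) A = β ∧ Quotient.mk (Brauer.CSA_Setoid K') B = γ ∧
    ∃ n m : ℕ, n ≠ 0 ∧ m ≠ 0 ∧
      Nonempty (Matrix (Fin n) (Fin n) (K' ⊗[K] A) ≃ₐ[K'] Matrix (Fin m) (Fin m) B)

/-- The relative Brauer group `Br(C₄ / K)`: the classes that become trivial on `C₄`, equivalently
(the curve being regular and integral) over its function field. -/
def relBrauer (K : Type) [Field K] [CharZero K] : Set (BrauerGroup.{0, 0} K) :=
  {β | BaseChangesTo (K' := FunField K) β (brauerOne (FunField K))}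

instance : Algebra.IsCentral ℝ ℍ[ℝ] where
  out := by
    intro q hq
    rw [Subalgebra.mem_center_iff] at hq
    have h1 := hq (⟨0, 1, 0, 0⟩ : ℍ[ℝ])
    have h2 := hq (⟨0, 0, 1, 0⟩ : ℍ[ℝ])
    have h13 := congrArg QuaternionAlgebra.imJ h1
    have h14 := congrArg QuaternionAlgebra.imK h1
    have h24 := congrArg QuaternionAlgebra.imK h2
    erw [Quaternion.imJ_mul, Quaternion.imJ_mul] at h13
    erw [Quaternion.imK_mul, Quaternion.imK_mul] at h14 h24
    simp only [zero_mul, mul_zero, one_mul, mul_one, add_zero, zero_add, sub_zero, zero_sub]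
      at h13 h14 h24
    rw [Algebra.mem_bot]
    refine ⟨q.re, ?_⟩
    change ((q.re : ℝ) : ℍ[ℝ]) = q
    ext <;> simp <;> linarith

/-- The class of Hamilton's quaternions in `Br(ℝ)`. -/
def hamiltonClass : BrauerGroup.{0, 0} ℝ :=
  Quotient.mk (Brauer.CSA_Setoid ℝ) { AlgCat.of ℝ ℍ[ℝ] with }

variable {L : Type} [Field L] [CharZero L] [Algebra ℚ L] [FiniteDimensional ℚ L]

/-- `A` is the crossed product algebra of `L / ℚ` and the 2-cocycle `a`: it is the left
`L`-vector space with basis `(e_σ)`, with `e_σ c = σ(c) e_σ` and `e_σ e_τ = a(σ, τ) e_{στ}`. -/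
def IsCrossedProduct (a : (L ≃ₐ[ℚ] L) → (L ≃ₐ[ℚ] L) → Lˣ)
    (A : Type) [Ring A] [Algebra ℚ A] : Prop :=
  ∃ (ι : L →ₐ[ℚ] A) (e : (L ≃ₐ[ℚ] L) → A),
    (∀ σ c, e σ * ι c = ι (σ c) * e σ) ∧
    (∀ σ τ, e σ * e τ = ι (a σ τ) * e (σ * τ)) ∧
    Function.Bijective fun c : (L ≃ₐ[ℚ] L) → L => ∑ σ, ι (c σ) * e σ

/-- `β ∈ Br(ℚ)` is the image of the Galois invariant class `x ∈ Pic(C₄ over L)`, for `L / ℚ` finite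
Galois, in the Brauer group: choose a divisor `D` in `x`, functions `u_σ` with
`div u_σ = D - σ D`, and let `β` be the class of the cocycle
`a(σ, τ) = u_σ σ(u_τ) / u_{στ} ∈ Lˣ`. -/
def HasBrauerImage (x : Pic L) (β : BrauerGroup.{0, 0} ℚ) : Prop :=
  ∃ (D : Divisor L) (u : (L ≃ₐ[ℚ] L) → FunField L) (a : (L ≃ₐ[ℚ] L) → (L ≃ₐ[ℚ] L) → Lˣ)
    (A : CSA.{0, 0} ℚ),
    cls D = x ∧
    (∀ σ, IsDiv (u σ) (D - galDiv σ D)) ∧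
    (∀ σ τ, algebraMap L (FunField L) (a σ τ) = u σ * galFun σ (u τ) / u (σ * τ)) ∧
    IsCrossedProduct a A ∧
    Quotient.mk (Brauer.CSA_Setoid ℚ) A = β

end Brauer

end FermatTwist

end

/-!
The four points `(ζᵏ, 0)`, `k` odd, of the affine curve `x⁴ + y⁴ + 1 = 0` are hyperflexes: if `H`
is the divisor cut out by the line at infinity, then `div (x - ζᵏ) = 4 (ζᵏ, 0) - H`, while `div y`
is the sum of the four points minus `H` (`ord_fx_sub`, `ord_fy`). In this chart
`E = 2 (ζ⁵, 0) - 2 (ζ, 0)` (`divE_eq`). Hence `E - σ E` is the divisor of an explicit function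
`u_σ`, namely `1`, `(x - ζ³)(x - ζ⁵) / y²`, `(x - ζ⁵) / (x - ζ)` or `(x - ζ⁵)(x - ζ⁷) / y²` according
to `σ ζ` (`isDiv_uFun`). This gives the invariance of `[E]`. Since `y⁴ = -∏ (x - ζᵏ)`, the cocycle
`u_σ σ(u_τ) / u_{στ}` is a sign, which is `-1` exactly if both `σ` and `τ` move `√-1 = ζ²`
(`uFun_mul`).

If `E` were equivalent to an invariant divisor, then `u_σ = c · f / σ f` for some function `f` and
some constants `c = c_σ`, because functions without poles are constant (`exists_eq_const`). For
`σ` the complex conjugation this gives `-1 = u_σ σ(u_σ) = c · σ c`, which is impossible as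
`c · σ c = |c|²` in `ℂ` (`not_cls_divE_eq_cls`).

The crossed product algebra of the cocycle is the matrix ring `M₂(ℍ)` over the rational quaternion
algebra `(-1, -1)`: this is checked on explicit matrices (`isCrossedProduct_matrix`). As other
choices of `D` and `u_σ` lead to a cohomologous cocycle (`exists_cohomologous`), and the crossed
product algebra depends only on the class of the cocycle, the image of `[E]` is the class of
`(-1, -1)`. It splits over `ℚ(C₄)`, where `-1 = (x²)² + (y²)²`, and it becomes the class of
Hamilton's quaternions over `ℝ`. A matrix ring over a noncommutative division algebra is never a
matrix ring over its center, by the dimensions of its left ideals (`isEmpty_matrix_algEquiv`), so these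
classes are nontrivial.

The curve enters through three facts on its function field: every nonconstant function has a zero
(`exists_place_lt_one`, from the primes of an integral closure of `K[X]`), `y` is a uniformizer at
the points `(w, 0)` with `w⁴ = -1` (`exists_eq_fy_zpow_mul`), and there is just one closed point
over each of them (`place_unique`).
-/

noncomputable section

namespace FermatTwist

/-! ### The function field and the existence of closed points -/

/-- The prime `X` of `k[X]` lies below a nonzero prime of the integral closure of `k[X]` in `F`,
which is a Dedekind domain. -/
theorem exists_valuationSubring_X_lt_one (k F : Type*) [Field k] [CharZero k] [Field F]
    [Algebra k F] [Algebra.EssFiniteType k F] [Algebra k[X] F] [IsScalarTower k k[X] F]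
    [FaithfulSMul k[X] F] [Algebra.IsAlgebraic k[X] F] :
    ∃ v : ValuationSubring F, (∀ c : k, algebraMap k F c ∈ v) ∧ IsDiscreteValuationRing v ∧
      v.valuation (algebraMap k[X] F X) < 1 := by
  let _ : Algebra (FractionRing k[X]) F := FractionRing.liftAlgebra k[X] F
  have : IsScalarTower k (FractionRing k[X]) F := IsScalarTower.to₁₃₄ k k[X] (FractionRing k[X]) F
  have : Algebra.EssFiniteType (FractionRing k[X]) F := Algebra.EssFiniteType.of_comp k _ _
  have : Algebra.IsAlgebraic (FractionRing k[X]) F := IsFractionRing.comap_isAlgebraic_iff.mp ‹_›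
  have : FiniteDimensional (FractionRing k[X]) F := Algebra.finite_of_essFiniteType_of_isAlgebraic
  let B := integralClosure k[X] F
  have : IsDedekindDomain B := integralClosure.isDedekindDomain_fractionRing k[X] F
  have : IsFractionRing B F :=
    integralClosure.isFractionRing_of_finite_extension (FractionRing k[X]) F
  have : IsScalarTower k B F := IsScalarTower.to₁₃₄ k k[X] B F
  let b : B := algebraMap k[X] B X
  have hb : ¬ IsUnit b := fun h =>
    not_isUnit_X (isUnit_of_map_unit (algebraMap k[X] B) _ h)
  obtain ⟨P, hP, hbP⟩ := exists_max_ideal_of_mem_nonunits hb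
  have hb0 : b ≠ 0 := fun h => X_ne_zero (R := k)
    (FaithfulSMul.algebraMap_injective k[X] B (h.trans (map_zero _).symm))
  let p : IsDedekindDomain.HeightOneSpectrum B :=
    ⟨P, hP.isPrime, fun h => hb0 (by simpa [h] using hbP)⟩
  refine ⟨(p.valuation F).valuationSubring, fun c => ?_, inferInstance, ?_⟩
  · rw [Valuation.mem_valuationSubring_iff, IsScalarTower.algebraMap_apply k B F]
    exact p.valuation_le_one _
  · have h : p.valuation F (algebraMap B F b) < 1 := (p.valuation_lt_one_iff_mem b).2 hbP
    rw [← map_one ((p.valuation F).valuationSubring.valuation),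
      ← ((Valuation.isEquiv_valuation_valuationSubring (p.valuation F)).lt_iff_lt), map_one,
      IsScalarTower.algebraMap_apply k[X] B F]
    exact h

/-- In a function field of one variable, every nonconstant function has a zero. -/
theorem exists_valuationSubring_lt_one {k F : Type*} [Field k] [CharZero k] [Field F]
    [Algebra k F] [Algebra.EssFiniteType k F] (htr : Algebra.trdeg k F ≤ 1) {g : F}
    (hg : Transcendental k g) :
    ∃ v : ValuationSubring F, (∀ c : k, algebraMap k F c ∈ v) ∧ IsDiscreteValuationRing v ∧
      v.valuation g < 1 := by
  let _ : Algebra k[X] F := (aeval g).toAlgebra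
  have : IsScalarTower k k[X] F := IsScalarTower.of_algebraMap_eq fun c => (aeval_C g c).symm
  have : FaithfulSMul k[X] F :=
    (faithfulSMul_iff_algebraMap_injective _ _).2 (transcendental_iff_injective.1 hg)
  have : Algebra.IsAlgebraic k[X] F := by
    rw [← trdeg_eq_zero_iff]
    have h := lift_trdeg_add_eq k k[X] F
    rw [Polynomial.trdeg_of_isDomain, Cardinal.lift_one] at h
    have h1 : 1 + Cardinal.lift (Algebra.trdeg k[X] F) ≤ 1 := by
      rw [h]; simpa using htr
    by_contra h0
    have h2 : 1 ≤ Cardinal.lift (Algebra.trdeg k[X] F) := by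
      simpa [Cardinal.one_le_iff_ne_zero] using h0
    have := (add_le_add_right h2 1).trans h1
    norm_num at this
  have h := exists_valuationSubring_X_lt_one k F
  rwa [show algebraMap k[X] F X = g from aeval_X g] at h

theorem root_pow (K : Type*) [Field K] :
    AdjoinRoot.root (affineEq K) ^ 4 = -(AdjoinRoot.of (affineEq K) X ^ 4 + 1) := by
  have h := AdjoinRoot.eval₂_root (affineEq K)
  rw [affineEq, eval₂_add, eval₂_X_pow, eval₂_C] at h
  have h2 : AdjoinRoot.root (affineEq K) ^ 4 + AdjoinRoot.of (affineEq K) (X ^ 4 + 1) = 0 := h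
  rw [map_add, map_pow, map_one] at h2
  exact eq_neg_of_add_eq_zero_left h2

section FunField

variable (K : Type*) [Field K] [CharZero K]

instance : Algebra.EssFiniteType K (FunField K) :=
  have : Algebra.EssFiniteType (CoordRing K) (FunField K) :=
    Algebra.EssFiniteType.of_isLocalization _ (nonZeroDivisors (CoordRing K))
  have : Algebra.FiniteType K (CoordRing K) := inferInstance
  Algebra.EssFiniteType.comp K (CoordRing K) (FunField K)

instance : FaithfulSMul K[X] (CoordRing K) := by
  rw [faithfulSMul_iff_algebraMap_injective]
  refine AdjoinRoot.of.injective_of_degree_ne_zero ?_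
  rw [degree_eq_natDegree (affineEq_monic K).ne_zero, affineEq_natDegree]
  norm_num

theorem trdeg_funField_le : Algebra.trdeg K (FunField K) ≤ 1 := by
  have : Module.Finite K[X] (CoordRing K) := (affineEq_monic K).finite_adjoinRoot
  have : Algebra.IsAlgebraic K[X] (FunField K) :=
    (IsFractionRing.isAlgebraic_iff' K[X] (CoordRing K) (FunField K)).1 inferInstance
  have : FaithfulSMul K[X] (FunField K) := inferInstance
  have h := lift_trdeg_add_eq K K[X] (FunField K)
  rw [Polynomial.trdeg_of_isDomain, trdeg_eq_zero] at h
  simp at h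
  simp [← h]

/-- The affine coordinate `x = X / Z`. -/
def fx : FunField K := algebraMap (CoordRing K) (FunField K) (AdjoinRoot.of (affineEq K) X)

/-- The affine coordinate `y = Y / Z`. -/
def fy : FunField K := algebraMap (CoordRing K) (FunField K) (AdjoinRoot.root (affineEq K))

theorem fy_pow : fy K ^ 4 = -(fx K ^ 4 + 1) := by
  have h := congrArg (algebraMap (CoordRing K) (FunField K)) (root_pow K)
  rwa [map_neg, map_add, map_pow, map_pow, map_one] at h

theorem transcendental_fx : Transcendental K (fx K) := by
  have : FaithfulSMul K[X] (FunField K) := inferInstance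
  rw [transcendental_iff_injective]
  convert FaithfulSMul.algebraMap_injective K[X] (FunField K) using 2
  ext p
  rw [IsScalarTower.algebraMap_apply K[X] (CoordRing K) (FunField K)]
  refine congrFun (congrArg DFunLike.coe
    (?_ : aeval (fx K) = IsScalarTower.toAlgHom K K[X] (FunField K))) p
  ext
  simpa [fx] using (IsScalarTower.algebraMap_apply K[X] (CoordRing K) (FunField K) X).symm

variable {K}

theorem exists_place_lt_one {g : FunField K} (hg : Transcendental K g) :
    ∃ v : Place K, v.1.valuation g < 1 := by
  obtain ⟨v, h1, h2, h3⟩ := exists_valuationSubring_lt_one (trdeg_funField_le K) hg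
  exact ⟨⟨v, h1, h2⟩, h3⟩

end FunField

/-! ### Orders of vanishing -/

section Order

variable {K : Type*} [Field K] [CharZero K] (v : Place K)

theorem adic_le_one_iff (f : FunField K) :
    (IsDiscreteValuationRing.maximalIdeal v.1).valuation (FunField K) f ≤ 1 ↔ f ∈ v.1 := by
  constructor
  · intro h
    obtain ⟨a, rfl⟩ := IsDiscreteValuationRing.exists_lift_of_le_one h
    exact a.2
  · intro h
    exact (IsDiscreteValuationRing.maximalIdeal v.1).valuation_le_one (K := FunField K) ⟨f, h⟩

theorem ord_nonneg_iff {f : FunField K} (hf : f ≠ 0) : 0 ≤ ord v f ↔ f ∈ v.1 := by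
  rw [← adic_le_one_iff, ord, neg_nonneg, ← WithZero.log_one,
    WithZero.log_le_log (by simpa using hf) one_ne_zero]

theorem ord_inv {f : FunField K} (hf : f ≠ 0) : ord v f⁻¹ = - ord v f := by
  have := ord_mul v hf (inv_ne_zero hf)
  rw [mul_inv_cancel₀ hf, ord_one] at this
  omega

theorem ord_div {f g : FunField K} (hf : f ≠ 0) (hg : g ≠ 0) :
    ord v (f / g) = ord v f - ord v g := by
  rw [div_eq_mul_inv, ord_mul v hf (inv_ne_zero hg), ord_inv v hg, sub_eq_add_neg]

theorem ord_pow {f : FunField K} (hf : f ≠ 0) (n : ℕ) : ord v (f ^ n) = n * ord v f := by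
  induction n with
  | zero => simp [ord_one]
  | succ n ih => rw [pow_succ, ord_mul v (pow_ne_zero n hf) hf, ih]; push_cast; ring

theorem ord_zpow {f : FunField K} (hf : f ≠ 0) (n : ℤ) : ord v (f ^ n) = n * ord v f := by
  cases n with
  | ofNat n => simpa using ord_pow v hf n
  | negSucc n =>
    rw [zpow_negSucc, ord_inv v (pow_ne_zero _ hf), ord_pow v hf, Int.negSucc_eq]; push_cast; ring

theorem ord_neg (f : FunField K) : ord v (-f) = ord v f := by
  rw [ord, Valuation.map_neg, ← ord]

theorem exists_ord_eq_one : ∃ t : FunField K, t ≠ 0 ∧ ord v t = 1 := by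
  obtain ⟨t, ht⟩ :=
    (IsDiscreteValuationRing.maximalIdeal v.1).valuation_exists_uniformizer (FunField K)
  refine ⟨t, ?_, ?_⟩
  · rintro rfl
    exact WithZero.exp_ne_zero (ht.symm.trans (map_zero _))
  · rw [ord, ht]; simp

theorem val_le_one_iff {f : FunField K} (hf : f ≠ 0) : v.1.valuation f ≤ 1 ↔ 0 ≤ ord v f := by
  rw [ord_nonneg_iff v hf, ValuationSubring.valuation_le_one_iff]

theorem val_lt_one_iff {f : FunField K} (hf : f ≠ 0) : v.1.valuation f < 1 ↔ 0 < ord v f := by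
  have h := val_le_one_iff v (inv_ne_zero hf)
  rw [ord_inv v hf, map_inv₀, inv_le_one₀ (by simpa [zero_lt_iff] using hf)] at h
  rw [← not_le, h]; omega

theorem val_eq_one_iff {f : FunField K} (hf : f ≠ 0) : v.1.valuation f = 1 ↔ ord v f = 0 := by
  have h1 := val_le_one_iff v hf
  have h2 := val_lt_one_iff v hf
  refine ⟨fun h => ?_, fun h => le_antisymm (h1.2 h.ge) (not_lt.1 fun h' => ?_)⟩
  · have h3 := h1.1 h.le
    have h4 : ¬ 0 < ord v f := fun h' => (h2.2 h').ne h
    omega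
  · have := h2.1 h'
    omega

theorem ord_eq_of_val_eq {f g : FunField K} (hf : f ≠ 0) (hg : g ≠ 0)
    (h : v.1.valuation f = v.1.valuation g) : ord v f = ord v g := by
  have : v.1.valuation (f / g) = 1 := by
    rw [map_div₀, h, div_self (by simpa using hg)]
  rw [val_eq_one_iff v (div_ne_zero hf hg), ord_div v hf hg] at this
  omega

/-- The order at a closed point is the only surjective valuation with the given valuation ring. -/
theorem ord_unique (φ : FunField K → ℤ) (hmul : ∀ f g, f ≠ 0 → g ≠ 0 → φ (f * g) = φ f + φ g)
    (hv : ∀ f, f ≠ 0 → (0 ≤ φ f ↔ f ∈ v.1)) (h1 : ∃ t, t ≠ 0 ∧ φ t = 1) {f : FunField K}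
    (hf : f ≠ 0) : φ f = ord v f := by
  obtain ⟨t, ht0, ht⟩ := exists_ord_eq_one v
  have hone : φ 1 = 0 := by
    have := hmul 1 1 one_ne_zero one_ne_zero
    rw [mul_one] at this; omega
  have hinv : ∀ f, f ≠ 0 → φ f⁻¹ = - φ f := fun f hf => by
    have := hmul f f⁻¹ hf (inv_ne_zero hf)
    rw [mul_inv_cancel₀ hf, hone] at this; omega
  have hpow : ∀ n : ℕ, φ (t ^ n) = n * φ t := fun n => by
    induction n with
    | zero => simp [hone]
    | succ n ih => rw [pow_succ, hmul _ _ (pow_ne_zero n ht0) ht0, ih]; push_cast; ring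
  have hzpow : ∀ n : ℤ, φ (t ^ n) = n * φ t := fun n => by
    cases n with
    | ofNat n => simpa using hpow n
    | negSucc n =>
      rw [zpow_negSucc, hinv _ (pow_ne_zero _ ht0), hpow, Int.negSucc_eq]; push_cast; ring
  have key : ∀ f, f ≠ 0 → φ f = ord v f * φ t := fun f hf => by
    have htn : t ^ (ord v f) ≠ 0 := zpow_ne_zero _ ht0
    have hu : f / t ^ (ord v f) ≠ 0 := div_ne_zero hf htn
    have ho : ord v (f / t ^ (ord v f)) = 0 := by
      rw [ord_div v hf htn, ord_zpow v ht0, ht]; ring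
    have h2 : 0 ≤ φ (f / t ^ (ord v f)) := (hv _ hu).2 ((ord_nonneg_iff v hu).1 ho.ge)
    have h3 : 0 ≤ φ (f / t ^ (ord v f))⁻¹ :=
      (hv _ (inv_ne_zero hu)).2
        ((ord_nonneg_iff v (inv_ne_zero hu)).1 (by rw [ord_inv v hu]; omega))
    rw [hinv _ hu] at h3
    have h4 := hmul _ _ hu htn
    rw [div_mul_cancel₀ _ htn, hzpow] at h4
    omega
  -- `φ = (φ t) · ord`, and `φ` takes the value `1`, so that `φ t = 1`
  obtain ⟨s, hs0, hs⟩ := h1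
  have hs' := key s hs0
  have ht' : 0 ≤ φ t := (hv t ht0).2 ((ord_nonneg_iff v ht0).1 (by omega))
  have : φ t = 1 := by
    rw [hs] at hs'
    exact Int.eq_one_of_dvd_one ht' (Dvd.intro_left _ hs'.symm)
  rw [key f hf, this, mul_one]

theorem val_const {c : K} (hc : c ≠ 0) : v.1.valuation (algebraMap K (FunField K) c) = 1 := by
  refine le_antisymm ((ValuationSubring.valuation_le_one_iff _ _).2 (v.2.1 c)) ?_
  have := (ValuationSubring.valuation_le_one_iff _ _).2 (v.2.1 c⁻¹)
  rwa [map_inv₀, map_inv₀, inv_le_one₀ (by simpa [zero_lt_iff] using hc)] at this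

theorem val_const_le (c : K) : v.1.valuation (algebraMap K (FunField K) c) ≤ 1 :=
  (ValuationSubring.valuation_le_one_iff _ _).2 (v.2.1 c)

/-- Two closed points with the same orders of vanishing have the same local ring. -/
theorem place_eq_of_ord_eq {v v' : Place K} (h : ∀ f, f ≠ 0 → ord v f = ord v' f) : v = v' := by
  refine Subtype.ext (ValuationSubring.ext _ _ fun f => ?_)
  by_cases hf : f = 0
  · simp [hf]
  · rw [← ord_nonneg_iff v hf, h f hf, ord_nonneg_iff v' hf]

end Order

/-! ### The local rings at the points `(w, 0)` -/

section Evaluation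

variable {K : Type*} [Field K]

/-- Evaluation of a function in the affine coordinate ring at the point `(w, 0)`, for `w⁴ = -1`. -/
def evalAt (w : K) (hw : w ^ 4 = -1) : CoordRing K →+* K :=
  AdjoinRoot.lift (evalRingHom w) 0 (by
    rw [affineEq, eval₂_add, eval₂_X_pow, eval₂_C]
    simp [hw])

theorem evalAt_algebraMap (w : K) (hw : w ^ 4 = -1) (c : K) :
    evalAt w hw (algebraMap K (CoordRing K) c) = c := by
  simp [evalAt, AdjoinRoot.algebraMap_eq']

theorem evalAt_root (w : K) (hw : w ^ 4 = -1) :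
    evalAt w hw (AdjoinRoot.root (affineEq K)) = 0 := by
  simp [evalAt]

theorem evalAt_X (w : K) (hw : w ^ 4 = -1) :
    evalAt w hw (AdjoinRoot.of (affineEq K) X) = w := by
  simp [evalAt]

/-- The kernel of evaluation at `(w, 0)` is generated by `x - w` and `y`. -/
theorem sub_evalAt_mem (w : K) (hw : w ^ 4 = -1) (r : CoordRing K) :
    r - algebraMap K _ (evalAt w hw r) ∈ Ideal.span {AdjoinRoot.of (affineEq K) X
      - algebraMap K _ w, AdjoinRoot.root (affineEq K)} := by
  set I := Ideal.span {AdjoinRoot.of (affineEq K) X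
      - algebraMap K _ w, AdjoinRoot.root (affineEq K)} with hI
  have h : Ideal.Quotient.mk I =
      ((Ideal.Quotient.mk I).comp (algebraMap K (CoordRing K))).comp (evalAt w hw) := by
    refine AdjoinRoot.ringHom_ext (Polynomial.ringHom_ext (fun c => ?_) ?_) ?_
    · have h1 : AdjoinRoot.of (affineEq K) (C c) = algebraMap K (CoordRing K) c := rfl
      simp only [RingHom.comp_apply, h1, evalAt_algebraMap]
    · simp only [RingHom.comp_apply, evalAt_X]
      rw [Ideal.Quotient.mk_eq_mk_iff_sub_mem]
      exact Ideal.subset_span (by simp)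
    · simp only [RingHom.comp_apply, evalAt_root, map_zero]
      rw [Ideal.Quotient.eq_zero_iff_mem]
      exact Ideal.subset_span (by simp)
  rw [← Ideal.Quotient.mk_eq_mk_iff_sub_mem]
  exact congrArg (fun φ => φ r) h

/-- The cofactor of `x - w` in `x⁴ + 1`, for `w⁴ = -1`. -/
def cofactor (w : K) : CoordRing K :=
  AdjoinRoot.of (affineEq K) (X ^ 3 + C w * X ^ 2 + C (w ^ 2) * X + C (w ^ 3))

theorem sub_mul_cofactor (w : K) (hw : w ^ 4 = -1) :
    (AdjoinRoot.of (affineEq K) X - algebraMap K _ w) * cofactor w =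
      - AdjoinRoot.root (affineEq K) ^ 4 := by
  have h1 : ∀ c, algebraMap K (CoordRing K) c = AdjoinRoot.of (affineEq K) (C c) := fun _ => rfl
  have h2 : (AdjoinRoot.of (affineEq K) (C w)) ^ 4 = -1 := by
    rw [← map_pow, ← C_pow, hw]; simp
  rw [root_pow K, cofactor, h1]
  simp only [map_add, map_mul, map_pow]
  linear_combination -h2

end Evaluation

section LocalRing

variable {K : Type*} [Field K] [CharZero K]

theorem fx_sub_ne_zero (w : K) : fx K - algebraMap K (FunField K) w ≠ 0 := fun h =>
  transcendental_fx K (by rw [sub_eq_zero.1 h]; exact isAlgebraic_algebraMap w)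

theorem fy_ne_zero : fy K ≠ 0 := fun h => by
  have h1 := fy_pow K
  rw [h, zero_pow four_ne_zero, eq_comm, neg_eq_zero] at h1
  refine transcendental_fx K ⟨X ^ 4 + 1, (monic_X_pow_add_C (1 : K) four_ne_zero).ne_zero, ?_⟩
  simpa using h1

theorem evalAt_cofactor_ne_zero (w : K) (hw : w ^ 4 = -1) : evalAt w hw (cofactor w) ≠ 0 := by
  have hw0 : w ≠ 0 := by rintro rfl; simp at hw
  have : evalAt w hw (cofactor w) = 4 * w ^ 3 := by
    simp [evalAt, cofactor]; ring
  rw [this]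
  exact mul_ne_zero (by norm_num) (pow_ne_zero _ hw0)

/-- `y` generates the maximal ideal of the local ring at `(w, 0)`: the factor `b` is a unit
there. -/
theorem exists_mul_eq_root_mul (w : K) (hw : w ^ 4 = -1) {r : CoordRing K}
    (hr : evalAt w hw r = 0) :
    ∃ b s, evalAt w hw b ≠ 0 ∧ b * r = AdjoinRoot.root (affineEq K) * s := by
  have h := sub_evalAt_mem w hw r
  rw [hr, map_zero, sub_zero, Ideal.mem_span_pair] at h
  obtain ⟨α, β, rfl⟩ := h
  refine ⟨cofactor w, -AdjoinRoot.root (affineEq K) ^ 3 * α + cofactor w * β,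
    evalAt_cofactor_ne_zero w hw, ?_⟩
  linear_combination α * sub_mul_cofactor w hw

variable {v : Place K}

/-- A closed point where `x` and `y` have no pole lies on the affine curve. -/
theorem algebraMap_coordRing_mem (hx : fx K ∈ v.1) (hy : fy K ∈ v.1) (r : CoordRing K) :
    algebraMap (CoordRing K) (FunField K) r ∈ v.1 := by
  induction r using AdjoinRoot.induction_on with | _ p
  induction p using Polynomial.induction_on' with
  | add p q hp hq => simpa using add_mem hp hq
  | monomial n a =>
    rw [← C_mul_X_pow_eq_monomial, map_mul, map_pow, map_mul, map_pow, AdjoinRoot.mk_C,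
      AdjoinRoot.mk_X]
    refine mul_mem ?_ (pow_mem hy n)
    induction a using Polynomial.induction_on' with
    | add p q hp hq => simpa using add_mem hp hq
    | monomial m c =>
      rw [← C_mul_X_pow_eq_monomial, map_mul, map_pow, map_mul, map_pow]
      exact mul_mem (v.2.1 c) (pow_mem hx m)

theorem fx_mem_of_val_lt {w : K} (h : v.1.valuation (fx K - algebraMap K _ w) < 1) :
    fx K ∈ v.1 := by
  have := add_mem ((ValuationSubring.valuation_le_one_iff _ _).1 h.le) (v.2.1 w)
  simpa using this

theorem val_fy_lt_one {w : K} (hw : w ^ 4 = -1)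
    (h : v.1.valuation (fx K - algebraMap K _ w) < 1) : v.1.valuation (fy K) < 1 := by
  have hx := fx_mem_of_val_lt h
  have hw' : algebraMap K (FunField K) w ^ 4 = -1 := by rw [← map_pow, hw]; simp
  have h1 : fy K ^ 4 = -((fx K - algebraMap K _ w) * (fx K ^ 3 + algebraMap K _ w * fx K ^ 2
      + algebraMap K _ w ^ 2 * fx K + algebraMap K _ w ^ 3)) := by
    rw [fy_pow]; linear_combination -hw'
  have h2 : v.1.valuation (fx K ^ 3 + algebraMap K _ w * fx K ^ 2
      + algebraMap K _ w ^ 2 * fx K + algebraMap K _ w ^ 3) ≤ 1 := by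
    rw [ValuationSubring.valuation_le_one_iff]
    have := v.2.1 w
    exact add_mem (add_mem (add_mem (pow_mem hx 3) (mul_mem this (pow_mem hx 2)))
      (mul_mem (pow_mem this 2) hx)) (pow_mem this 3)
  have h3 : v.1.valuation (fy K) ^ 4 < 1 := by
    rw [← map_pow, h1, Valuation.map_neg, map_mul]
    exact mul_lt_one_of_lt_of_le h h2
  exact (pow_lt_one_iff four_ne_zero).1 h3

theorem val_sub_evalAt_lt_one {w : K} (hw : w ^ 4 = -1)
    (h : v.1.valuation (fx K - algebraMap K _ w) < 1) (r : CoordRing K) :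
    v.1.valuation (algebraMap _ (FunField K) r - algebraMap K _ (evalAt w hw r)) < 1 := by
  have hy := val_fy_lt_one hw h
  have hmem := algebraMap_coordRing_mem (fx_mem_of_val_lt h)
    ((ValuationSubring.valuation_le_one_iff _ _).1 hy.le)
  obtain ⟨α, β, hαβ⟩ := Ideal.mem_span_pair.1 (sub_evalAt_mem w hw r)
  have h1 := congrArg (algebraMap (CoordRing K) (FunField K)) hαβ
  rw [map_sub, ← IsScalarTower.algebraMap_apply K (CoordRing K) (FunField K)] at h1
  rw [← h1, map_add, map_mul, map_mul, map_sub,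
    ← IsScalarTower.algebraMap_apply K (CoordRing K) (FunField K)]
  refine Valuation.map_add_lt _ ?_ ?_
  · rw [map_mul, mul_comm]
    exact mul_lt_one_of_lt_of_le h ((ValuationSubring.valuation_le_one_iff _ _).2 (hmem α))
  · rw [map_mul, mul_comm]
    exact mul_lt_one_of_lt_of_le hy ((ValuationSubring.valuation_le_one_iff _ _).2 (hmem β))

theorem val_coordRing_eq_one {w : K} (hw : w ^ 4 = -1)
    (h : v.1.valuation (fx K - algebraMap K _ w) < 1) {r : CoordRing K}
    (hr : evalAt w hw r ≠ 0) : v.1.valuation (algebraMap _ (FunField K) r) = 1 := by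
  have h1 := val_sub_evalAt_lt_one hw h r
  have h2 := val_const v hr
  rw [← sub_add_cancel (algebraMap _ (FunField K) r) (algebraMap K _ (evalAt w hw r)),
    Valuation.map_add_eq_of_lt_right _ (by rwa [h2]), h2]

/-- A nonzero regular function is a power of `y` times a unit `a / b` of the local ring at
`(w, 0)`. -/
theorem exists_mul_eq_root_pow_mul {w : K} (hw : w ^ 4 = -1)
    (h : v.1.valuation (fx K - algebraMap K _ w) < 1) {r : CoordRing K} (hr : r ≠ 0) :
    ∃ (n : ℕ) (a b : CoordRing K), evalAt w hw a ≠ 0 ∧ evalAt w hw b ≠ 0 ∧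
      b * r = AdjoinRoot.root (affineEq K) ^ n * a := by
  have hy := val_fy_lt_one hw h
  have hy1 := (val_lt_one_iff v fy_ne_zero).1 hy
  -- induction on the order of vanishing of `r`
  obtain ⟨m, hm⟩ : ∃ m : ℕ, ord v (algebraMap _ (FunField K) r) ≤ m := ⟨_, Int.self_le_toNat _⟩
  induction m generalizing r with
  | zero =>
    refine ⟨0, r, 1, fun hr0 => ?_, by simp, by simp⟩
    have h1 := val_sub_evalAt_lt_one hw h r
    rw [hr0, map_zero, sub_zero, val_lt_one_iff v (by simpa using hr)] at h1
    push_cast at hm; omega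
  | succ m ih =>
    by_cases hr0 : evalAt w hw r = 0
    · obtain ⟨b, s, hb, hbs⟩ := exists_mul_eq_root_mul w hw hr0
      have hb0 : b ≠ 0 := fun h => hb (by rw [h, map_zero])
      have hs : s ≠ 0 := fun h => mul_ne_zero hb0 hr (by rw [hbs, h, mul_zero])
      have h1 := congrArg (algebraMap (CoordRing K) (FunField K)) hbs
      rw [map_mul, map_mul] at h1
      have h2 := congrArg (ord v) h1
      change _ = ord v (fy K * _) at h2
      rw [ord_mul v (by simpa using hb0) (by simpa using hr),
        ord_mul v fy_ne_zero (by simpa using hs),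
        (val_eq_one_iff v (by simpa using hb0)).1 (val_coordRing_eq_one hw h hb)] at h2
      obtain ⟨n, a, b', ha, hb', hab⟩ := ih hs (by push_cast at hm; omega)
      refine ⟨n + 1, a, b' * b, ha, by rw [map_mul]; exact mul_ne_zero hb' hb, ?_⟩
      linear_combination b' * hbs + AdjoinRoot.root (affineEq K) * hab
    · exact ⟨0, r, 1, hr0, by simp, by simp⟩

/-- Every nonzero rational function is a power of `y` times a unit at `(w, 0)`. -/
theorem exists_eq_fy_zpow_mul {w : K} (hw : w ^ 4 = -1)
    (h : v.1.valuation (fx K - algebraMap K _ w) < 1) {f : FunField K} (hf : f ≠ 0) :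
    ∃ (n : ℤ) (a b : CoordRing K), evalAt w hw a ≠ 0 ∧ evalAt w hw b ≠ 0 ∧
      f = fy K ^ n * (algebraMap _ (FunField K) a / algebraMap _ (FunField K) b) := by
  obtain ⟨r, s, hs, rfl⟩ := IsFractionRing.div_surjective (CoordRing K) f
  have hs0 : s ≠ 0 := nonZeroDivisors.ne_zero hs
  have hr0 : r ≠ 0 := by rintro rfl; simp at hf
  obtain ⟨n, a, b, ha, hb, hab⟩ := exists_mul_eq_root_pow_mul hw h hr0
  obtain ⟨n', a', b', ha', hb', hab'⟩ := exists_mul_eq_root_pow_mul hw h hs0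
  refine ⟨n - n', a * b', b * a', by rw [map_mul]; exact mul_ne_zero ha hb',
    by rw [map_mul]; exact mul_ne_zero hb ha', ?_⟩
  have h0 : ∀ {c : CoordRing K}, evalAt w hw c ≠ 0 → algebraMap _ (FunField K) c ≠ 0 :=
    fun {c} hc h => hc (by rw [(map_eq_zero_iff _ (IsFractionRing.injective _ _)).1 h, map_zero])
  have h1 := congrArg (algebraMap (CoordRing K) (FunField K)) hab
  have h2 := congrArg (algebraMap (CoordRing K) (FunField K)) hab'
  simp only [map_mul, map_pow] at h1 h2
  change _ = fy K ^ _ * _ at h1 h2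
  have e1 := h0 hb
  have e2 := h0 hb'
  have e3 := h0 ha'
  have e4 : algebraMap _ (FunField K) s ≠ 0 := by simpa using hs0
  have e5 := fy_ne_zero (K := K)
  rw [zpow_sub₀ e5, zpow_natCast, zpow_natCast, map_mul, map_mul]
  field_simp
  linear_combination (algebraMap _ (FunField K) a' * fy K ^ n') * h1 -
    (algebraMap _ (FunField K) a * fy K ^ n) * h2

theorem ord_fy_zpow_mul {w : K} (hw : w ^ 4 = -1)
    (h : v.1.valuation (fx K - algebraMap K _ w) < 1) (n : ℤ) {a b : CoordRing K}
    (ha : evalAt w hw a ≠ 0) (hb : evalAt w hw b ≠ 0) :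
    ord v (fy K ^ n * (algebraMap _ (FunField K) a / algebraMap _ (FunField K) b)) =
      n * ord v (fy K) := by
  have h1 := val_coordRing_eq_one hw h ha
  have h2 := val_coordRing_eq_one hw h hb
  have h3 : algebraMap _ (FunField K) a ≠ 0 := fun h => by simp [h] at h1
  have h4 : algebraMap _ (FunField K) b ≠ 0 := fun h => by simp [h] at h2
  rw [ord_mul v (zpow_ne_zero _ fy_ne_zero) (div_ne_zero h3 h4), ord_div v h3 h4,
    (val_eq_one_iff v h3).1 h1, (val_eq_one_iff v h4).1 h2, ord_zpow v fy_ne_zero]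
  ring

theorem ord_fy_eq_one {w : K} (hw : w ^ 4 = -1)
    (h : v.1.valuation (fx K - algebraMap K _ w) < 1) : ord v (fy K) = 1 := by
  obtain ⟨t, ht0, ht⟩ := exists_ord_eq_one v
  obtain ⟨n, a, b, ha, hb, rfl⟩ := exists_eq_fy_zpow_mul hw h ht0
  rw [ord_fy_zpow_mul hw h n ha hb] at ht
  exact Int.eq_one_of_dvd_one ((val_lt_one_iff v fy_ne_zero).1 (val_fy_lt_one hw h)).le
    (Dvd.intro_left _ ht)

/-- There is at most one closed point with center `(w, 0)`. -/
theorem place_unique {w : K} (hw : w ^ 4 = -1) {v' : Place K}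
    (h : v.1.valuation (fx K - algebraMap K _ w) < 1)
    (h' : v'.1.valuation (fx K - algebraMap K _ w) < 1) : v = v' := by
  refine place_eq_of_ord_eq fun f hf => ?_
  obtain ⟨n, a, b, ha, hb, rfl⟩ := exists_eq_fy_zpow_mul hw h hf
  rw [ord_fy_zpow_mul hw h n ha hb, ord_fy_zpow_mul hw h' n ha hb, ord_fy_eq_one hw h,
    ord_fy_eq_one hw h']

/-- The residue field at `(w, 0)` is `K`. -/
theorem exists_val_sub_const_lt_one {w : K} (hw : w ^ 4 = -1)
    (h : v.1.valuation (fx K - algebraMap K _ w) < 1) {f : FunField K} (hf : f ∈ v.1) :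
    ∃ c : K, v.1.valuation (f - algebraMap K _ c) < 1 := by
  by_cases hf1 : v.1.valuation f < 1
  · exact ⟨0, by simpa using hf1⟩
  have hf0 : f ≠ 0 := by rintro rfl; simp at hf1
  rw [val_lt_one_iff v hf0] at hf1
  have hf2 := (ord_nonneg_iff v hf0).2 hf
  obtain ⟨n, a, b, ha, hb, rfl⟩ := exists_eq_fy_zpow_mul hw h hf0
  rw [ord_fy_zpow_mul hw h n ha hb, ord_fy_eq_one hw h, mul_one] at hf1 hf2
  obtain rfl : n = 0 := by omega
  have h2 := val_coordRing_eq_one hw h hb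
  have h4 : algebraMap _ (FunField K) b ≠ 0 := fun h => by simp [h] at h2
  refine ⟨evalAt w hw a / evalAt w hw b, ?_⟩
  have h5 := val_sub_evalAt_lt_one hw h
    (a - algebraMap K _ (evalAt w hw a / evalAt w hw b) * b)
  rw [map_sub (evalAt w hw), map_mul (evalAt w hw), evalAt_algebraMap, div_mul_cancel₀ _ hb,
    sub_self, map_zero, sub_zero, map_sub, map_mul,
    ← IsScalarTower.algebraMap_apply K (CoordRing K) (FunField K)] at h5
  have h6 : fy K ^ (0 : ℤ) * (algebraMap _ (FunField K) a / algebraMap _ (FunField K) b) -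
      algebraMap K _ (evalAt w hw a / evalAt w hw b) = (algebraMap _ (FunField K) a -
      algebraMap K (FunField K) (evalAt w hw a / evalAt w hw b) * algebraMap _ (FunField K) b) /
      algebraMap _ (FunField K) b := by
    field_simp
  rw [h6, map_div₀, h2, div_one]
  exact h5

theorem placeDegree_eq_one {w : K} (hw : w ^ 4 = -1)
    (h : v.1.valuation (fx K - algebraMap K _ w) < 1) : placeDegree v = 1 := by
  unfold placeDegree
  let _ : Algebra K (IsLocalRing.ResidueField v.1) :=
    ((IsLocalRing.residue v.1).comp (constHom v)).toAlgebra
  refine finrank_eq_one (1 : IsLocalRing.ResidueField v.1) one_ne_zero fun r => ?_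
  obtain ⟨f, rfl⟩ := IsLocalRing.residue_surjective r
  obtain ⟨c, hc⟩ := exists_val_sub_const_lt_one hw h f.2
  refine ⟨c, ?_⟩
  rw [Algebra.smul_def, mul_one]
  change IsLocalRing.residue v.1 (constHom v c) = _
  rw [eq_comm, ← sub_eq_zero, ← map_sub, IsLocalRing.residue_eq_zero_iff,
    ValuationSubring.valuation_lt_one_iff]
  exact hc

theorem exists_place_at (w : K) :
    ∃ v : Place K, v.1.valuation (fx K - algebraMap K _ w) < 1 := by
  refine exists_place_lt_one fun h => transcendental_fx K ?_
  simpa using h.add (isAlgebraic_algebraMap w)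

/-- The closed point `(w, 0)` of the curve, for `w⁴ = -1`; for other `w`, some closed point on the
line `x = w`. -/
def placeAt (w : K) : Place K := (exists_place_at w).choose

theorem val_placeAt (w : K) : (placeAt w).1.valuation (fx K - algebraMap K _ w) < 1 :=
  (exists_place_at w).choose_spec

theorem eq_placeAt_iff {w : K} (hw : w ^ 4 = -1) :
    v = placeAt w ↔ v.1.valuation (fx K - algebraMap K _ w) < 1 :=
  ⟨fun h => h ▸ val_placeAt w, fun h => place_unique hw h (val_placeAt w)⟩

theorem mem_of_isAlgebraic (v : Place K) {f : FunField K} (hf : IsAlgebraic K f) : f ∈ v.1 := by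
  let _ : Algebra K v.1 := (constHom v).toAlgebra
  have : IsScalarTower K v.1 (FunField K) := IsScalarTower.of_algebraMap_eq fun _ => rfl
  obtain ⟨a, rfl⟩ := IsIntegrallyClosed.isIntegral_iff.1 (hf.isIntegral.tower_top (A := v.1))
  exact a.2

/-- A rational function without poles is constant, provided that `C₄` has a rational point
`(w, 0)`. -/
theorem exists_eq_const {w : K} (hw : w ^ 4 = -1) {f : FunField K}
    (hf : ∀ v : Place K, f ∈ v.1) : ∃ c : K, f = algebraMap K _ c := by
  obtain ⟨c, hc⟩ := exists_val_sub_const_lt_one hw (val_placeAt w) (hf _)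
  refine ⟨c, sub_eq_zero.1 (by_contra fun hg => ?_)⟩
  set g := f - algebraMap K (FunField K) c with hg'
  have hgm : ∀ v : Place K, g ∈ v.1 := fun v => sub_mem (hf v) (v.2.1 c)
  -- `g` has a zero at `(w, 0)`; if it is not `0`, then it is transcendental, so that it has a pole
  by_cases halg : IsAlgebraic K g
  · have h := (ValuationSubring.valuation_le_one_iff _ _).2
      (mem_of_isAlgebraic (placeAt w) halg.inv)
    rw [map_inv₀, inv_le_one₀ (by simpa [zero_lt_iff] using hg)] at h
    exact hc.not_ge h
  · obtain ⟨v, hv⟩ := exists_place_lt_one (g := g⁻¹) (fun h => halg (by simpa using h.inv))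
    rw [map_inv₀, inv_lt_one₀ (by simpa [zero_lt_iff] using hg)] at hv
    exact hv.not_ge ((ValuationSubring.valuation_le_one_iff _ _).2 (hgm v))

end LocalRing

/-! ### The divisors of `x - w` and `y` -/

theorem pow_odd_pow_four {R : Type*} [CommRing R] {ζ : R} (hζ : ζ ^ 4 = -1) (k : ℕ) :
    (ζ ^ (2 * k + 1)) ^ 4 = -1 := by
  rw [← pow_mul, mul_comm, pow_mul, hζ, pow_succ, pow_mul]
  simp

section Center

variable {K : Type*} [Field K] [CharZero K]

/-- The point `[1 : 0 : z]` is the point `(z⁻¹, 0)` of the affine chart. -/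
theorem hasCenter_iff {z : K} (hz : z ^ 4 = -1) (v : Place K) :
    HasCenter v ![1, 0, z] ↔ v = placeAt z⁻¹ := by
  have hz0 : z ≠ 0 := by rintro rfl; simp at hz
  have hw : z⁻¹ ^ 4 = -1 := by rw [inv_pow, hz]; norm_num
  have hxz : algebraMap K (FunField K) z * (fx K - algebraMap K _ z⁻¹) =
      algebraMap K (FunField K) z * fx K - 1 := by
    rw [mul_sub, ← map_mul, mul_inv_cancel₀ hz0, map_one]
  have hval : v.1.valuation (algebraMap K (FunField K) z * fx K - 1) =
      v.1.valuation (fx K - algebraMap K _ z⁻¹) := by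
    rw [← hxz, map_mul, val_const v hz0, one_mul]
  have c0 : coord K 0 = fx K := rfl
  have c1 : coord K 1 = fy K := rfl
  have c2 : coord K 2 = 1 := rfl
  rw [eq_placeAt_iff hw, ← hval]
  constructor
  · rintro ⟨-, h⟩
    obtain ⟨k, hk⟩ := h 0 1
    obtain ⟨l, hl⟩ := h 2 0
    simp only [Matrix.cons_val, c0, c1, c2, map_one, map_zero, one_mul, zero_mul, sub_zero] at hk hl
    -- the largest of the values of the coordinates is neither that of `y` nor that of `x`
    have hx : v.1.valuation (fx K) ≤ 1 := by
      by_contra! hx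
      have hzx : v.1.valuation (algebraMap K (FunField K) z * fx K - 1) =
          v.1.valuation (fx K) := by
        have h1 : v.1.valuation (algebraMap K (FunField K) z * fx K) = v.1.valuation (fx K) := by
          rw [map_mul, val_const v hz0, one_mul]
        rw [sub_eq_add_neg,
          Valuation.map_add_eq_of_lt_left _ (by rwa [Valuation.map_neg, map_one, h1]), h1]
      rw [hzx] at hl
      have hxy : v.1.valuation (fx K) < v.1.valuation (fy K) := by
        fin_cases l
        · exact absurd hl (lt_irrefl _)
        · exact hl
        · exact absurd (hl.trans hx) (by simp)
      fin_cases k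
      · exact absurd (hk.trans hxy) (lt_irrefl _)
      · exact absurd hk (lt_irrefl _)
      · exact absurd (hk.trans (hx.trans hxy)) (by simp)
    have hy : v.1.valuation (fy K) < 1 := by
      fin_cases k
      · exact hk.trans_le hx
      · exact absurd hk (lt_irrefl _)
      · simpa [c2] using hk
    fin_cases l
    · exact hl.trans_le hx
    · exact hl.trans hy
    · simpa [c2] using hl
  · intro h
    have hy := val_fy_lt_one hw (hval ▸ h)
    have hzy : v.1.valuation (algebraMap K (FunField K) z * fy K) < 1 := by
      rwa [map_mul, val_const v hz0, one_mul]
    refine ⟨fun h0 => by simpa using congrFun h0 0, fun i j => ⟨2, ?_⟩⟩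
    rw [c2, map_one]
    fin_cases i <;> fin_cases j <;>
      simp only [Fin.reduceFinMk, Fin.zero_eta, Fin.mk_one, Matrix.cons_val, c0, c1, c2, map_one,
        map_zero, one_mul, zero_mul, mul_one, sub_zero, sub_self, zero_sub, Valuation.map_neg]
    all_goals first
      | exact zero_lt_one
      | exact hy
      | exact h
      | exact hzy
      | rwa [Valuation.map_sub_swap]

theorem point_eq {z : K} (hz : z ^ 4 = -1) :
    point ![1, 0, z] = Finsupp.single (placeAt z⁻¹) 1 := by
  have hc : HasCenter (placeAt z⁻¹) ![1, 0, z] := (hasCenter_iff hz _).2 rfl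
  rw [point, finsum_eq_single _ ⟨placeAt z⁻¹, hc⟩]
  rintro ⟨v, hv⟩ hne
  exact absurd (Subtype.ext ((hasCenter_iff hz v).1 hv)) hne

theorem divE_eq {ζ : K} (hζ : ζ ^ 4 = -1) :
    divE ζ = Finsupp.single (placeAt (ζ ^ 5)) 2 - Finsupp.single (placeAt ζ) 2 := by
  have h8 : ζ ^ 8 = 1 := by linear_combination (ζ ^ 4 - 1) * hζ
  have h3 : (ζ ^ 3)⁻¹ = ζ ^ 5 := inv_eq_of_mul_eq_one_right (by rw [← pow_add, h8])
  have h7 : (ζ ^ 7)⁻¹ = ζ := inv_eq_of_mul_eq_one_right (by rw [← pow_succ, h8])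
  rw [divE, point_eq (by rw [← pow_mul, mul_comm, pow_mul, hζ]; norm_num),
    point_eq (by rw [← pow_mul, mul_comm, pow_mul, hζ]; norm_num), h3, h7]
  simp

/-- Minus the intersection multiplicity at `v` of `C₄` with the line at infinity `Z = 0`. This is
the order of `x = X / Z` at the points at infinity, because `X` does not vanish there, and they are
exactly the points where `x` is not regular. -/
def orderAtInfinity (v : Place K) : ℤ :=
  open Classical in if fx K ∈ v.1 then 0 else ord v (fx K)

/-- The divisor of `x - w` is four times the point `(w, 0)` minus the line section at infinity:
`x = w` is the tangent at a hyperflex. -/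
theorem ord_fx_sub {w : K} (hw : w ^ 4 = -1) (v : Place K) :
    ord v (fx K - algebraMap K _ w) =
      4 * Finsupp.single (placeAt w) (1 : ℤ) v + orderAtInfinity v := by
  classical
  have hne := fx_sub_ne_zero w
  rw [orderAtInfinity, Finsupp.single_apply]
  by_cases hx : fx K ∈ v.1
  · rw [if_pos hx]
    by_cases h : v.1.valuation (fx K - algebraMap K _ w) < 1
    · rw [if_pos ((eq_placeAt_iff hw).2 h).symm]
      have h1 := congrArg (algebraMap (CoordRing K) (FunField K)) (sub_mul_cofactor w hw)
      rw [map_mul, map_sub, ← IsScalarTower.algebraMap_apply K (CoordRing K) (FunField K), map_neg,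
        map_pow] at h1
      change (fx K - algebraMap K _ w) * _ = -(fy K ^ 4) at h1
      have h2 := val_coordRing_eq_one hw h (evalAt_cofactor_ne_zero w hw)
      have h3 : algebraMap _ (FunField K) (cofactor w) ≠ 0 := fun h => by simp [h] at h2
      have h4 := congrArg (ord v) h1
      rw [ord_mul v hne h3, (val_eq_one_iff v h3).1 h2, ord_neg, ord_pow v fy_ne_zero,
        ord_fy_eq_one hw h] at h4
      push_cast at h4
      omega
    · rw [if_neg (fun h' => h ((eq_placeAt_iff hw).1 h'.symm))]
      have h1 : 0 ≤ ord v (fx K - algebraMap K _ w) :=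
        (ord_nonneg_iff v hne).2 (sub_mem hx (v.2.1 w))
      rw [val_lt_one_iff v hne] at h
      omega
  · rw [if_neg hx]
    have hx1 : 1 < v.1.valuation (fx K) := by
      rwa [← not_le, ValuationSubring.valuation_le_one_iff]
    have hx0 : fx K ≠ 0 := fun h => hx (h ▸ zero_mem _)
    have h1 : v.1.valuation (fx K - algebraMap K _ w) = v.1.valuation (fx K) := by
      rw [sub_eq_add_neg, Valuation.map_add_eq_of_lt_left]
      rw [Valuation.map_neg]
      exact (val_const_le v w).trans_lt hx1
    rw [ord_eq_of_val_eq v hne hx0 h1, if_neg]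
    · simp
    · intro h'
      exact hx (fx_mem_of_val_lt ((eq_placeAt_iff hw).1 h'.symm))

theorem fy_pow_eq_prod {ζ : K} (hζ : ζ ^ 4 = -1) :
    fy K ^ 4 = -((fx K - algebraMap K _ ζ) * (fx K - algebraMap K _ (ζ ^ 3)) *
      (fx K - algebraMap K _ (ζ ^ 5)) * (fx K - algebraMap K _ (ζ ^ 7))) := by
  have h : algebraMap K (FunField K) ζ ^ 4 = -1 := by rw [← map_pow, hζ]; simp
  have h3 : ζ ^ 5 = -ζ := by linear_combination ζ * hζ
  have h5 : ζ ^ 7 = -ζ ^ 3 := by linear_combination ζ ^ 3 * hζ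
  rw [fy_pow, h3, h5]
  simp only [map_neg, map_pow]
  linear_combination (-fx K ^ 2 * algebraMap K (FunField K) ζ ^ 2 +
    algebraMap K (FunField K) ζ ^ 4 - 1) * h

/-- The divisor of `y`, obtained from those of the four factors `x - ζᵏ` of `-y⁴`. -/
theorem ord_fy {ζ : K} (hζ : ζ ^ 4 = -1) (v : Place K) :
    ord v (fy K) = Finsupp.single (placeAt ζ) (1 : ℤ) v + Finsupp.single (placeAt (ζ ^ 3)) (1 : ℤ) v
      + Finsupp.single (placeAt (ζ ^ 5)) (1 : ℤ) v + Finsupp.single (placeAt (ζ ^ 7)) (1 : ℤ) v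
      + orderAtInfinity v := by
  have h := congrArg (ord v) (fy_pow_eq_prod hζ)
  have n := fx_sub_ne_zero (K := K)
  rw [ord_pow v fy_ne_zero, ord_neg, ord_mul v (mul_ne_zero (mul_ne_zero (n _) (n _)) (n _)) (n _),
    ord_mul v (mul_ne_zero (n _) (n _)) (n _), ord_mul v (n _) (n _), ord_fx_sub hζ,
    ord_fx_sub (pow_odd_pow_four hζ 1), ord_fx_sub (pow_odd_pow_four hζ 2),
    ord_fx_sub (pow_odd_pow_four hζ 3)] at h
  push_cast at h
  omega

end Center

/-! ### The functions `u_σ` -/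

section SelectOdd

variable {K : Type*} [Field K] {α : Type*}

open Classical in
/-- The value `a₁`, `a₃`, `a₅` or `a₇`, according to whether `η` is `ζ`, `ζ³`, `ζ⁵` or `ζ⁷`. It is
used to define functions of an automorphism `σ` of `ℚ(ζ₈)` in terms of `η = σ ζ`. -/
def selectOdd (ζ η : K) (a₁ a₃ a₅ a₇ : α) : α :=
  if η = ζ then a₁ else if η = ζ ^ 3 then a₃ else if η = ζ ^ 5 then a₅ else a₇

theorem selectOdd_one (ζ : K) (a₁ a₃ a₅ a₇ : α) : selectOdd ζ ζ a₁ a₃ a₅ a₇ = a₁ := if_pos rfl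

theorem selectOdd_three {ζ : K} (hζ : IsPrimitiveRoot ζ 8) (a₁ a₃ a₅ a₇ : α) :
    selectOdd ζ (ζ ^ 3) a₁ a₃ a₅ a₇ = a₃ := by
  have h1 : ζ ^ 3 ≠ ζ := fun h =>
    absurd (hζ.pow_inj (by norm_num : 3 < 8) (by norm_num : 1 < 8) (by simpa using h)) (by norm_num)
  rw [selectOdd, if_neg h1, if_pos rfl]

theorem selectOdd_five {ζ : K} (hζ : IsPrimitiveRoot ζ 8) (a₁ a₃ a₅ a₇ : α) :
    selectOdd ζ (ζ ^ 5) a₁ a₃ a₅ a₇ = a₅ := by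
  have h1 : ζ ^ 5 ≠ ζ := fun h =>
    absurd (hζ.pow_inj (by norm_num : 5 < 8) (by norm_num : 1 < 8) (by simpa using h)) (by norm_num)
  have h3 : ζ ^ 5 ≠ ζ ^ 3 := fun h =>
    absurd (hζ.pow_inj (by norm_num : 5 < 8) (by norm_num : 3 < 8) h) (by norm_num)
  rw [selectOdd, if_neg h1, if_neg h3, if_pos rfl]

theorem selectOdd_seven {ζ : K} (hζ : IsPrimitiveRoot ζ 8) (a₁ a₃ a₅ a₇ : α) :
    selectOdd ζ (ζ ^ 7) a₁ a₃ a₅ a₇ = a₇ := by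
  have h1 : ζ ^ 7 ≠ ζ := fun h =>
    absurd (hζ.pow_inj (by norm_num : 7 < 8) (by norm_num : 1 < 8) (by simpa using h)) (by norm_num)
  have h3 : ζ ^ 7 ≠ ζ ^ 3 := fun h =>
    absurd (hζ.pow_inj (by norm_num : 7 < 8) (by norm_num : 3 < 8) h) (by norm_num)
  have h5 : ζ ^ 7 ≠ ζ ^ 5 := fun h =>
    absurd (hζ.pow_inj (by norm_num : 7 < 8) (by norm_num : 5 < 8) h) (by norm_num)
  rw [selectOdd, if_neg h1, if_neg h3, if_neg h5]

end SelectOdd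

section Divisors

variable {K : Type*} [Field K] [CharZero K]

theorem IsDiv.mul {f g : FunField K} {D D' : Divisor K} (h : IsDiv f D) (h' : IsDiv g D') :
    IsDiv (f * g) (D + D') :=
  ⟨mul_ne_zero h.1 h'.1, fun v => by rw [ord_mul v h.1 h'.1, ← h.2, ← h'.2, Finsupp.add_apply]⟩

theorem IsDiv.div {f g : FunField K} {D D' : Divisor K} (h : IsDiv f D) (h' : IsDiv g D') :
    IsDiv (f / g) (D - D') :=
  ⟨div_ne_zero h.1 h'.1, fun v => by rw [ord_div v h.1 h'.1, ← h.2, ← h'.2, Finsupp.sub_apply]⟩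

/-- Two functions with the same divisor differ by a constant factor. -/
theorem IsDiv.exists_eq_const_mul {w : K} (hw : w ^ 4 = -1) {f g : FunField K} {D : Divisor K}
    (h : IsDiv f D) (h' : IsDiv g D) : ∃ c : K, c ≠ 0 ∧ f = algebraMap K _ c * g := by
  have hd := h.div h'
  obtain ⟨c, hc⟩ := exists_eq_const hw (f := f / g) fun v => by
    rw [← ord_nonneg_iff v hd.1, ← hd.2, sub_self, Finsupp.zero_apply]
  refine ⟨c, ?_, by rw [← hc, div_mul_cancel₀ _ h'.1]⟩
  rintro rfl
  exact hd.1 (by rw [hc, map_zero])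

theorem cls_eq_iff {D D' : Divisor K} : cls D = cls D' ↔ ∃ f, IsDiv f (D - D') := by
  rw [cls, cls, eq_comm, QuotientAddGroup.mk'_eq_mk']
  constructor
  · rintro ⟨z, hz, h⟩
    rw [← h, add_sub_cancel_left]
    exact hz
  · intro h
    exact ⟨_, h, add_sub_cancel _ _⟩

theorem degree_divE {ζ : K} (hζ : ζ ^ 4 = -1) : degree K (divE ζ) = 0 := by
  rw [divE_eq hζ, map_sub]
  simp [degree, placeDegree_eq_one hζ (val_placeAt ζ),
    placeDegree_eq_one (pow_odd_pow_four hζ 2) (val_placeAt (ζ ^ 5))]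

/-- The linear form `x - w`, as a rational function. -/
def lin (w : K) : FunField K := fx K - algebraMap K _ w

theorem lin_ne_zero (w : K) : lin w ≠ 0 := fx_sub_ne_zero w

theorem eq_or_eq_of_pow_four {R : Type*} [CommRing R] [IsDomain R] {ζ η : R} (hζ : ζ ^ 4 = -1)
    (hη : η ^ 4 = -1) :
    η = ζ ∨ η = ζ ^ 3 ∨ η = ζ ^ 5 ∨ η = ζ ^ 7 := by
  have : (η - ζ) * ((η - ζ ^ 3) * ((η - ζ ^ 5) * (η - ζ ^ 7))) = 0 := by
    have h3 : ζ ^ 5 = -ζ := by linear_combination ζ * hζ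
    have h5 : ζ ^ 7 = -ζ ^ 3 := by linear_combination ζ ^ 3 * hζ
    rw [h3, h5]
    linear_combination hη - (η ^ 2 * ζ ^ 2 - ζ ^ 4 + 1) * hζ
  simpa [sub_eq_zero] using this

/-- The function `u_σ` with divisor `E - σ E`, where `η = σ ζ`; it depends on `η` only. -/
def uFun (ζ η : K) : FunField K :=
  selectOdd ζ η 1 (lin (ζ ^ 3) * lin (ζ ^ 5) / fy K ^ 2) (lin (ζ ^ 5) / lin ζ)
    (lin (ζ ^ 5) * lin (ζ ^ 7) / fy K ^ 2)

theorem uFun_one (ζ : K) : uFun ζ ζ = 1 := selectOdd_one ..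

theorem uFun_three {ζ : K} (hζ : IsPrimitiveRoot ζ 8) :
    uFun ζ (ζ ^ 3) = lin (ζ ^ 3) * lin (ζ ^ 5) / fy K ^ 2 := selectOdd_three hζ ..

theorem uFun_five {ζ : K} (hζ : IsPrimitiveRoot ζ 8) : uFun ζ (ζ ^ 5) = lin (ζ ^ 5) / lin ζ :=
  selectOdd_five hζ ..

theorem uFun_seven {ζ : K} (hζ : IsPrimitiveRoot ζ 8) :
    uFun ζ (ζ ^ 7) = lin (ζ ^ 5) * lin (ζ ^ 7) / fy K ^ 2 := selectOdd_seven hζ ..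

theorem pow_four_of_isPrimitiveRoot {R : Type*} [CommRing R] [IsDomain R] {ζ : R}
    (hζ : IsPrimitiveRoot ζ 8) : ζ ^ 4 = -1 :=
  (hζ.pow (by norm_num) (by norm_num : 8 = 4 * 2)).eq_neg_one_of_two_right

end Divisors

section Galois

variable {K : Type*} [Field K] [CharZero K]

theorem funField_ringHom_ext {R : Type*} [CommRing R] {φ ψ : FunField K →+* R}
    (hc : ∀ c : K, φ (algebraMap K _ c) = ψ (algebraMap K _ c)) (hx : φ (fx K) = ψ (fx K))
    (hy : φ (fy K) = ψ (fy K)) : φ = ψ := by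
  refine IsLocalization.ringHom_ext (nonZeroDivisors (CoordRing K)) ?_
  refine AdjoinRoot.ringHom_ext (Polynomial.ringHom_ext (fun c => ?_) hx) hy
  exact hc c

variable [Algebra ℚ K]

theorem galFun_fx (σ : K ≃ₐ[ℚ] K) : galFun σ (fx K) = fx K := by
  rw [galFun, fx, IsFractionRing.ringEquivOfRingEquiv_algebraMap]
  congr 1
  simp [galCoordRing]

theorem galFun_fy (σ : K ≃ₐ[ℚ] K) : galFun σ (fy K) = fy K := by
  rw [galFun, fy, IsFractionRing.ringEquivOfRingEquiv_algebraMap]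
  congr 1
  simp [galCoordRing]

theorem galFun_mul (σ τ : K ≃ₐ[ℚ] K) (f : FunField K) :
    galFun (σ * τ) f = galFun σ (galFun τ f) := by
  have h : (galFun (σ * τ) : FunField K →+* FunField K) =
      (galFun σ : FunField K →+* FunField K).comp (galFun τ) := by
    refine funField_ringHom_ext (fun c => ?_) ?_ ?_
    · simp [galFun_const]
    · simp [galFun_fx]
    · simp [galFun_fy]
  exact congrArg (fun φ : FunField K →+* FunField K => φ f) h

theorem galFun_one (f : FunField K) : galFun (1 : K ≃ₐ[ℚ] K) f = f := by
  have h : (galFun (1 : K ≃ₐ[ℚ] K) : FunField K →+* FunField K) = RingHom.id _ := by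
    refine funField_ringHom_ext (fun c => ?_) ?_ ?_
    · simp [galFun_const]
    · simp [galFun_fx]
    · simp [galFun_fy]
  exact congrArg (fun φ : FunField K →+* FunField K => φ f) h

theorem mem_galPlace_iff (σ : K ≃ₐ[ℚ] K) (v : Place K) (f : FunField K) :
    galFun σ f ∈ (galPlace σ v).1 ↔ f ∈ v.1 := by
  change galFun σ f ∈ v.1.comap (galFun σ).symm.toRingHom ↔ _
  rw [ValuationSubring.mem_comap, RingEquiv.toRingHom_eq_coe, RingHom.coe_coe,
    RingEquiv.symm_apply_apply]

theorem galPlace_injective (σ : K ≃ₐ[ℚ] K) : Function.Injective (galPlace σ) := fun v v' h => by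
  refine Subtype.ext (ValuationSubring.ext _ _ fun f => ?_)
  rw [← mem_galPlace_iff σ v, h, mem_galPlace_iff]

theorem galPlace_surjective (σ : K ≃ₐ[ℚ] K) : Function.Surjective (galPlace σ) := fun v => by
  refine ⟨galPlace σ⁻¹ v, Subtype.ext (ValuationSubring.ext _ _ fun f => ?_)⟩
  obtain ⟨g, rfl⟩ := (galFun σ).surjective f
  rw [mem_galPlace_iff, ← mem_galPlace_iff σ⁻¹ v (galFun σ g), ← galFun_mul, inv_mul_cancel,
    galFun_one]

theorem ord_galPlace (σ : K ≃ₐ[ℚ] K) (v : Place K) {f : FunField K} (hf : f ≠ 0) :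
    ord (galPlace σ v) (galFun σ f) = ord v f := by
  have h0 : ∀ {f : FunField K}, f ≠ 0 → galFun σ f ≠ 0 := fun h => by simpa using h
  refine ord_unique v (fun f => ord (galPlace σ v) (galFun σ f)) (fun f g hf hg => ?_)
    (fun f hf => ?_) ?_ hf
  · simp only [map_mul]
    exact ord_mul _ (h0 hf) (h0 hg)
  · rw [ord_nonneg_iff _ (h0 hf), mem_galPlace_iff]
  · obtain ⟨t, ht0, ht⟩ := exists_ord_eq_one (galPlace σ v)
    obtain ⟨s, rfl⟩ := (galFun σ).surjective t
    exact ⟨s, by simpa using ht0, ht⟩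

theorem galDiv_apply (σ : K ≃ₐ[ℚ] K) (D : Divisor K) (v : Place K) :
    galDiv σ D (galPlace σ v) = D v :=
  Finsupp.mapDomain_apply (galPlace_injective σ) D v

theorem IsDiv.gal {f : FunField K} {D : Divisor K} (h : IsDiv f D) (σ : K ≃ₐ[ℚ] K) :
    IsDiv (galFun σ f) (galDiv σ D) := by
  refine ⟨by simpa using h.1, fun v => ?_⟩
  obtain ⟨v, rfl⟩ := galPlace_surjective σ v
  rw [galDiv_apply, ord_galPlace σ v h.1, h.2]

theorem galPlace_placeAt (σ : K ≃ₐ[ℚ] K) {w : K} (hw : w ^ 4 = -1) :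
    galPlace σ (placeAt w) = placeAt (σ w) := by
  have hw' : (σ w) ^ 4 = -1 := by rw [← map_pow, hw]; simp
  have h : galFun σ (fx K - algebraMap K _ w) = fx K - algebraMap K _ (σ w) := by
    rw [map_sub, galFun_fx, galFun_const]
  rw [eq_placeAt_iff hw', val_lt_one_iff _ (fx_sub_ne_zero _), ← h,
    ord_galPlace σ _ (fx_sub_ne_zero _), ← val_lt_one_iff _ (fx_sub_ne_zero _)]
  exact val_placeAt w

theorem galDiv_divE (σ : K ≃ₐ[ℚ] K) {ζ : K} (hζ : ζ ^ 4 = -1) :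
    galDiv σ (divE ζ) =
      Finsupp.single (placeAt (σ ζ ^ 5)) 2 - Finsupp.single (placeAt (σ ζ)) 2 := by
  rw [divE_eq hζ, map_sub]
  simp only [galDiv, Finsupp.mapDomain.addMonoidHom_apply, Finsupp.mapDomain_single]
  rw [galPlace_placeAt σ hζ, galPlace_placeAt σ (pow_odd_pow_four hζ 2), map_pow]

theorem galFun_lin (σ : K ≃ₐ[ℚ] K) (w : K) : galFun σ (lin w) = lin (σ w) := by
  rw [lin, map_sub, galFun_fx, galFun_const, lin]

theorem isDiv_uFun {ζ : K} (hζ : IsPrimitiveRoot ζ 8) (σ : K ≃ₐ[ℚ] K) :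
    IsDiv (uFun ζ (σ ζ)) (divE ζ - galDiv σ (divE ζ)) := by
  have h4 := pow_four_of_isPrimitiveRoot hζ
  have h8 := hζ.pow_eq_one
  have hl := lin_ne_zero (K := K)
  have hy := pow_ne_zero 2 (fy_ne_zero (K := K))
  have e1 : ∀ v : Place K, ord v (lin ζ) = _ := ord_fx_sub h4
  have e3 : ∀ v : Place K, ord v (lin (ζ ^ 3)) = _ := ord_fx_sub (pow_odd_pow_four h4 1)
  have e5 : ∀ v : Place K, ord v (lin (ζ ^ 5)) = _ := ord_fx_sub (pow_odd_pow_four h4 2)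
  have e7 : ∀ v : Place K, ord v (lin (ζ ^ 7)) = _ := ord_fx_sub (pow_odd_pow_four h4 3)
  have two : ∀ (p v : Place K), Finsupp.single p (2 : ℤ) v = 2 * Finsupp.single p (1 : ℤ) v :=
    fun p v => by
      rw [show (2 : ℤ) = (2 : ℤ) • (1 : ℤ) by simp, ← Finsupp.smul_single, Finsupp.smul_apply]; simp
  rw [galDiv_divE σ h4, divE_eq h4]
  rcases eq_or_eq_of_pow_four h4 (η := σ ζ) (by rw [← map_pow, h4]; simp) with h | h | h | h <;>
    rw [h]
  · rw [uFun_one, sub_self]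
    exact ⟨one_ne_zero, fun v => (ord_one v).symm⟩
  · rw [uFun_three hζ, ← pow_mul, show ζ ^ (3 * 5) = ζ ^ 7 by
      rw [show 3 * 5 = 8 + 7 by rfl, pow_add, h8, one_mul]]
    refine ⟨div_ne_zero (mul_ne_zero (hl _) (hl _)) hy, fun v => ?_⟩
    rw [ord_div v (mul_ne_zero (hl _) (hl _)) hy, ord_mul v (hl _) (hl _), ord_pow v fy_ne_zero,
      e3, e5, ord_fy h4]
    simp only [Finsupp.sub_apply, two]
    push_cast; ring
  · rw [uFun_five hζ, ← pow_mul, show ζ ^ (5 * 5) = ζ by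
      rw [show 5 * 5 = 8 * 3 + 1 by rfl, pow_add, pow_mul, h8]; simp]
    refine ⟨div_ne_zero (hl _) (hl _), fun v => ?_⟩
    rw [ord_div v (hl _) (hl _), e1, e5]
    simp only [Finsupp.sub_apply, two]
    ring
  · rw [uFun_seven hζ, ← pow_mul, show ζ ^ (7 * 5) = ζ ^ 3 by
      rw [show 7 * 5 = 8 * 4 + 3 by rfl, pow_add, pow_mul, h8]; simp]
    refine ⟨div_ne_zero (mul_ne_zero (hl _) (hl _)) hy, fun v => ?_⟩
    rw [ord_div v (mul_ne_zero (hl _) (hl _)) hy, ord_mul v (hl _) (hl _), ord_pow v fy_ne_zero,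
      e5, e7, ord_fy h4]
    simp only [Finsupp.sub_apply, two]
    push_cast; ring

end Galois

/-! ### The cocycle and the non-existence of an invariant divisor -/

section Cocycle

variable {K : Type*} [Field K] [CharZero K] [Algebra ℚ K]

open Classical in
/-- The sign `±1` of the cocycle attached to `E`: it is `-1` exactly if both automorphisms move
`ζ² = √-1`. -/
def cocycleSign (ζ : K) (σ τ : K ≃ₐ[ℚ] K) : Kˣ :=
  if σ ζ ^ 2 ≠ ζ ^ 2 ∧ τ ζ ^ 2 ≠ ζ ^ 2 then -1 else 1

/-- The functions `u_σ` satisfy the cocycle relation up to the sign `cocycleSign`. -/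
theorem uFun_mul {ζ : K} (hζ : IsPrimitiveRoot ζ 8) (σ τ : K ≃ₐ[ℚ] K) :
    uFun ζ (σ ζ) * galFun σ (uFun ζ (τ ζ)) =
      algebraMap K (FunField K) (cocycleSign ζ σ τ) * uFun ζ ((σ * τ) ζ) := by
  have h4 := pow_four_of_isPrimitiveRoot hζ
  have red : ∀ k, ζ ^ k = ζ ^ (k % 8) := fun k => pow_eq_pow_mod k hζ.pow_eq_one
  have hn := lin_ne_zero (K := K)
  have n1 := hn ζ
  have n3 := hn (ζ ^ 3)
  have n5 := hn (ζ ^ 5)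
  have n7 := hn (ζ ^ 7)
  have hy := fy_ne_zero (K := K)
  have hy4 : fy K ^ 4 = -(lin ζ * lin (ζ ^ 3) * lin (ζ ^ 5) * lin (ζ ^ 7)) := fy_pow_eq_prod h4
  have hσ := eq_or_eq_of_pow_four h4 (η := σ ζ) (by rw [← map_pow, h4]; simp)
  have hτ := eq_or_eq_of_pow_four h4 (η := τ ζ) (by rw [← map_pow, h4]; simp)
  have p2 : ζ ^ 6 ≠ ζ ^ 2 := fun h =>
    absurd (hζ.pow_inj (by norm_num : 6 < 8) (by norm_num : 2 < 8) h) (by norm_num)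
  have hστ : (σ * τ) ζ = σ (τ ζ) := rfl
  rw [hστ, cocycleSign]
  rcases hσ with h | h | h | h <;> rcases hτ with h' | h' | h' | h' <;>
    simp only [h, h', map_pow, ← pow_mul, Nat.reduceMul, red 9, red 15, red 21, red 25, red 35,
      red 49, red 14, red 10, Nat.reduceMod, pow_one, uFun_one, uFun_three hζ, uFun_five hζ,
      uFun_seven hζ, map_mul, map_div₀, galFun_lin, galFun_fy, map_one, ne_eq, not_true, p2,
      not_false_iff, and_true, and_false, if_true, if_false, Units.val_one, Units.val_neg, map_neg]
    <;> field_simp <;> try linear_combination hy4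

/-- A Galois extension of `ℚ` containing `ζ₈` has an automorphism inducing complex conjugation
with respect to some complex embedding. -/
theorem exists_conj (M : Type*) [Field M] [Algebra ℚ M] [IsGalois ℚ M] :
    ∃ (φ : M →+* ℂ) (σ : M ≃ₐ[ℚ] M), ∀ m, φ (σ m) = starRingEnd ℂ (φ m) := by
  let φ : M →ₐ[ℚ] ℂ := IsAlgClosed.lift
  let _ : Algebra M ℂ := φ.toRingHom.toAlgebra
  have : IsScalarTower ℚ M ℂ := IsScalarTower.of_algebraMap_eq fun q => (φ.commutes q).symm
  exact ⟨φ, (Complex.conjAe.restrictScalars ℚ).restrictNormal M, fun m =>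
    AlgEquiv.restrictNormal_commutes (Complex.conjAe.restrictScalars ℚ) M m⟩

/-- `E` is not equivalent to an invariant divisor: with `σ` complex conjugation, such a divisor
would give `c` with `c · σ c = -1`, where the left hand side is positive. -/
theorem not_cls_divE_eq_cls [IsGalois ℚ K] {ζ : K} (hζ : IsPrimitiveRoot ζ 8) {D : Divisor K}
    (hD : DefinedOverRat D) : cls (divE ζ) ≠ cls D := by
  intro h
  have h4 := pow_four_of_isPrimitiveRoot hζ
  obtain ⟨f, hf⟩ := cls_eq_iff.1 h
  obtain ⟨φ, σ, hσ⟩ := exists_conj K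
  have hσζ : σ ζ = ζ ^ 7 := by
    apply φ.injective
    have h1 : ‖φ ζ‖ = 1 := by
      refine (pow_eq_one_iff_of_nonneg (norm_nonneg _) (by norm_num : 8 ≠ 0)).1 ?_
      rw [← norm_pow, ← map_pow, hζ.pow_eq_one, map_one, norm_one]
    have h2 : φ ζ * starRingEnd ℂ (φ ζ) = 1 := by
      rw [Complex.mul_conj, Complex.normSq_eq_norm_sq, h1]; simp
    have h3 : φ ζ * φ (ζ ^ 7) = 1 := by
      rw [← map_mul, ← pow_succ', hζ.pow_eq_one, map_one]
    rw [hσ]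
    exact mul_left_cancel₀ (left_ne_zero_of_mul_eq_one h2) (h2.trans h3.symm)
  have hσσ : σ * σ = 1 := AlgEquiv.ext fun m => φ.injective (by simp [hσ])
  -- `f / σ f` has the divisor `E - σ E`
  have hdiv : IsDiv (f / galFun σ f) (divE ζ - galDiv σ (divE ζ)) := by
    have := hf.div (hf.gal σ)
    rwa [map_sub, hD σ, sub_sub_sub_cancel_right] at this
  obtain ⟨c, hc, hcu⟩ := (isDiv_uFun hζ σ).exists_eq_const_mul h4 hdiv
  have hf0 := hf.1
  have hsf0 := (hf.gal σ).1
  have hff : galFun σ (galFun σ f) = f := by rw [← galFun_mul, hσσ, galFun_one]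
  -- `u_σ = c f / σ f` turns `u_σ σ(u_σ) = -1` into `c σ(c) = -1`
  have hu := uFun_mul hζ σ σ
  have hsign : cocycleSign ζ σ σ = -1 := by
    have : (ζ ^ 7) ^ 2 ≠ ζ ^ 2 := by
      rw [← pow_mul, pow_eq_pow_mod _ hζ.pow_eq_one]
      exact fun h => absurd (hζ.pow_inj (by norm_num) (by norm_num) h) (by norm_num)
    rw [cocycleSign, hσζ, if_pos ⟨this, this⟩]
  rw [hsign, hσσ, AlgEquiv.one_apply, uFun_one, hcu, map_mul, map_div₀, hff, galFun_const] at hu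
  have hcc : algebraMap K (FunField K) (c * σ c) = algebraMap K (FunField K) (-1) := by
    rw [map_mul, ← mul_one (algebraMap K (FunField K) (-1))]
    simp only [Units.val_neg, Units.val_one] at hu
    rw [← hu]
    field_simp
  have hφ := congrArg φ ((algebraMap K (FunField K)).injective hcc)
  rw [map_mul, hσ, Complex.mul_conj, map_neg, map_one] at hφ
  have : Complex.normSq (φ c) = -1 := by exact_mod_cast hφ
  linarith [Complex.normSq_nonneg (φ c)]

end Cocycle

/-! ### Hamilton quaternions over `ℚ`, `ℝ` and `ℚ(C₄)` -/

section DivisionAlgebra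

/-- A matrix ring over a noncommutative division algebra is not a matrix ring over the center:
the left ideal of `M_m(K)` generated by a matrix unit has dimension `m`, which is too small for a
nonzero left ideal of `M_n(D)`. -/
theorem isEmpty_matrix_algEquiv {K D : Type*} [Field K] [DivisionRing D] [Algebra K D]
    [FiniteDimensional K D] (hD : 1 < Module.finrank K D) {n m : ℕ} (hn : n ≠ 0) (hm : m ≠ 0) :
    IsEmpty (Matrix (Fin n) (Fin n) D ≃ₐ[K] Matrix (Fin m) (Fin m) K) := by
  refine ⟨fun φ => ?_⟩
  have : NeZero m := ⟨hm⟩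
  let e : Matrix (Fin m) (Fin m) K := Matrix.single 0 0 1
  have he : φ.symm e ≠ 0 := by
    rw [ne_eq, map_eq_zero_iff _ φ.symm.injective]
    intro h
    have := congrFun (congrFun h 0) 0
    simp [e] at this
  obtain ⟨i, j, hij⟩ : ∃ i j, φ.symm e i j ≠ 0 := by
    by_contra! h
    exact he (Matrix.ext h)
  -- the left multiples of `e` by matrices concentrated in column `i`
  let T : (Fin n → D) →ₗ[K] (Fin m → K) :=
    { toFun := fun d r => φ (Matrix.of fun k l => d k * φ.symm e i l) r 0
      map_add' := fun d d' => by
        ext r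
        rw [Pi.add_apply, ← Matrix.add_apply, ← map_add]
        refine congrFun (congrFun (congrArg φ (Matrix.ext fun k l => ?_)) r) 0
        simp [add_mul]
      map_smul' := fun c d => by
        ext r
        rw [Pi.smul_apply, ← Matrix.smul_apply, RingHom.id_apply, ← map_smul]
        refine congrFun (congrFun (congrArg φ (Matrix.ext fun k l => ?_)) r) 0
        simp }
  have hT : Function.Injective T := by
    rw [← LinearMap.ker_eq_bot, LinearMap.ker_eq_bot']
    intro d hd
    let y : Matrix (Fin n) (Fin n) D := Matrix.of fun k l => if l = i then d k else 0
    have hy : (Matrix.of fun k l => d k * φ.symm e i l) = y * φ.symm e := by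
      ext k l
      simp [y, Matrix.mul_apply]
    have h0 : φ (Matrix.of fun k l => d k * φ.symm e i l) = 0 := by
      ext r s
      by_cases hs : s = 0
      · subst hs
        exact congrFun hd r
      · rw [hy, map_mul, AlgEquiv.apply_symm_apply, Matrix.mul_apply]
        simp [e, Ne.symm hs]
    rw [map_eq_zero_iff _ φ.injective] at h0
    ext k
    have := congrFun (congrFun h0 k) j
    simpa [hij] using this
  have h1 := LinearMap.finrank_le_finrank_of_injective hT
  have h2 := φ.toLinearEquiv.finrank_eq
  rw [Module.finrank_matrix, Module.finrank_matrix] at h2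
  simp only [Module.finrank_pi_fintype, Finset.sum_const, Finset.card_univ, Fintype.card_fin,
    Module.finrank_self, smul_eq_mul, mul_one] at h1 h2
  have h3 : m ≤ n := by
    by_contra! h
    nlinarith
  nlinarith [Nat.pos_of_ne_zero hn]

end DivisionAlgebra

/-- The quaternion `a + b i + c j + d k`. -/
def quat {R : Type*} [CommRing R] (a b c d : R) : ℍ[R] := ⟨a, b, c, d⟩

section Quat

variable {R : Type*} [CommRing R] (a b c d a' b' c' d' : R)

theorem quat_eta (q : ℍ[R]) : q = quat q.re q.imI q.imJ q.imK := rfl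

theorem quat_mul : quat a b c d * quat a' b' c' d' =
    quat (a * a' - b * b' - c * c' - d * d') (a * b' + b * a' + c * d' - d * c')
      (a * c' - b * d' + c * a' + d * b') (a * d' + b * c' - c * b' + d * a') := by
  apply Quaternion.ext
  · exact Quaternion.re_mul _ _
  · exact Quaternion.imI_mul _ _
  · exact Quaternion.imJ_mul _ _
  · exact Quaternion.imK_mul _ _

theorem quat_add : quat a b c d + quat a' b' c' d' = quat (a + a') (b + b') (c + c') (d + d') := rfl

theorem quat_neg : -quat a b c d = quat (-a) (-b) (-c) (-d) := rfl

theorem quat_sub : quat a b c d - quat a' b' c' d' = quat (a - a') (b - b') (c - c') (d - d') := rfl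

theorem quat_smul {S : Type*} [SMul S R] (s : S) :
    s • quat a b c d = quat (s • a) (s • b) (s • c) (s • d) := rfl

theorem quat_one : (1 : ℍ[R]) = quat 1 0 0 0 := rfl

theorem quat_zero : (0 : ℍ[R]) = quat 0 0 0 0 := rfl

end Quat

section Hamilton

instance (R : Type*) [Field R] [CharZero R] : Algebra.IsCentral R ℍ[R] where
  out := by
    intro q hq
    rw [Subalgebra.mem_center_iff] at hq
    have h1 := hq (⟨0, 1, 0, 0⟩ : ℍ[R])
    have h2 := hq (⟨0, 0, 1, 0⟩ : ℍ[R])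
    have h13 : _ = _ := congrArg QuaternionAlgebra.imJ h1
    have h14 : _ = _ := congrArg QuaternionAlgebra.imK h1
    have h24 : _ = _ := congrArg QuaternionAlgebra.imK h2
    erw [Quaternion.imJ_mul, Quaternion.imJ_mul] at h13
    erw [Quaternion.imK_mul, Quaternion.imK_mul] at h14 h24
    simp only [zero_mul, mul_zero, one_mul, mul_one, add_zero, zero_add, sub_zero, zero_sub]
      at h13 h14 h24
    rw [Algebra.mem_bot]
    refine ⟨q.re, ?_⟩
    change ((q.re : R) : ℍ[R]) = q
    have e1 : q.imI = 0 := by linear_combination (-1/2 : R) * h24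
    have e2 : q.imJ = 0 := by linear_combination (1/2 : R) * h14
    have e3 : q.imK = 0 := by linear_combination (-1/2 : R) * h13
    ext <;> simp [e1, e2, e3]

/-- The class of the rational quaternion algebra `(-1, -1)` in `Br(ℚ)`. -/
def ratHamiltonClass : BrauerGroup.{0, 0} ℚ :=
  Quotient.mk (Brauer.CSA_Setoid ℚ) { AlgCat.of ℚ ℍ[ℚ] with }

theorem hamiltonClass_ne_one : hamiltonClass ≠ brauerOne ℝ := by
  intro h
  obtain ⟨n, m, hn, hm, ⟨φ⟩⟩ := Quotient.exact h
  exact (isEmpty_matrix_algEquiv (K := ℝ) (D := ℍ[ℝ]) (by rw [Quaternion.finrank_eq_four]; norm_num)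
    hn hm).false φ

theorem ratHamiltonClass_ne_one : ratHamiltonClass ≠ brauerOne ℚ := by
  intro h
  obtain ⟨n, m, hn, hm, ⟨φ⟩⟩ := Quotient.exact h
  exact (isEmpty_matrix_algEquiv (K := ℚ) (D := ℍ[ℚ]) (by rw [Quaternion.finrank_eq_four]; norm_num)
    hn hm).false φ

/-- An algebra of dimension four over `F ⊇ ℚ` spanned by `1, i, j, k` with the relations of
`(-1, -1)` is `F ⊗ (-1, -1)`. -/
theorem nonempty_tensor_quaternion_algEquiv {F T : Type*} [Field F] [Algebra ℚ F] [Ring T]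
    [Algebra ℚ T] [Algebra F T] [IsScalarTower ℚ F T]
    (hT : Module.finrank F T = 4) (q : QuaternionAlgebra.Basis T (-1 : ℚ) 0 (-1))
    (hq : ∀ t : T, ∃ a b c d : F, t = a • 1 + b • q.i + c • q.j + d • q.k) :
    Nonempty (F ⊗[ℚ] ℍ[ℚ] ≃ₐ[F] T) := by
  have : FiniteDimensional F T := Module.finite_of_finrank_pos (by omega)
  let Φ : F ⊗[ℚ] ℍ[ℚ] →ₐ[F] T := Algebra.TensorProduct.lift (Algebra.ofId F T)
    (q.liftHom : ℍ[ℚ] →ₐ[ℚ] T) fun a b => Algebra.commutes a _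
  have hΦ : ∀ a x, Φ (a ⊗ₜ x) = algebraMap F T a * q.lift x := fun a x =>
    Algebra.TensorProduct.lift_tmul ..
  have hs : Function.Surjective Φ := by
    intro t
    obtain ⟨a, b, c, d, rfl⟩ := hq t
    refine ⟨a ⊗ₜ 1 + b ⊗ₜ quat 0 1 0 0 + c ⊗ₜ quat 0 0 1 0 + d ⊗ₜ quat 0 0 0 1, ?_⟩
    simp only [map_add, hΦ]
    simp [QuaternionAlgebra.Basis.lift, quat_one, quat, Algebra.smul_def]
  refine ⟨AlgEquiv.ofBijective Φ ⟨?_, hs⟩⟩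
  refine (LinearMap.injective_iff_surjective_of_finrank_eq_finrank (f := Φ.toLinearMap) ?_).2 hs
  rw [Module.finrank_baseChange, Quaternion.finrank_eq_four, hT]

/-- `ℝ ⊗ (-1, -1)` is Hamilton's quaternion algebra. -/
theorem baseChangesTo_hamiltonClass :
    BaseChangesTo (K' := ℝ) ratHamiltonClass hamiltonClass := by
  let q : QuaternionAlgebra.Basis ℍ[ℝ] (-1 : ℚ) 0 (-1) :=
    { i := quat 0 1 0 0
      j := quat 0 0 1 0
      k := quat 0 0 0 1
      i_mul_i := by simp [quat_mul, quat_one, quat_neg]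
      j_mul_j := by simp [quat_mul, quat_one, quat_neg]
      i_mul_j := by simp [quat_mul]
      j_mul_i := by simp [quat_mul, quat_neg] }
  obtain ⟨φ⟩ := nonempty_tensor_quaternion_algEquiv (F := ℝ) Quaternion.finrank_eq_four q fun t =>
    ⟨t.re, t.imI, t.imJ, t.imK, by
      rw [quat_eta t]
      simp only [q, quat_one, quat_smul, quat_add]
      simp [quat]
      rfl⟩
  exact ⟨_, _, rfl, rfl, 1, 1, one_ne_zero, one_ne_zero, ⟨φ.mapMatrix⟩⟩

/-- If `-1 = a² + b²` in `F`, then `(-1, -1)` splits over `F`. -/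
theorem nonempty_tensor_quaternion_algEquiv_matrix {F : Type*} [Field F] [Algebra ℚ F]
    {a b : F} (hab : a ^ 2 + b ^ 2 = -1) :
    Nonempty (F ⊗[ℚ] ℍ[ℚ] ≃ₐ[F] Matrix (Fin 2) (Fin 2) F) := by
  have : CharZero F := algebraRat.charZero F
  let q : QuaternionAlgebra.Basis (Matrix (Fin 2) (Fin 2) F) (-1 : ℚ) 0 (-1) :=
    { i := !![0, -1; 1, 0]
      j := !![a, b; b, -a]
      k := !![-b, a; a, b]
      i_mul_i := by
        ext i j
        fin_cases i <;> fin_cases j <;> simp [Matrix.mul_apply]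
      j_mul_j := by
        ext i j
        fin_cases i <;> fin_cases j <;> simp [Matrix.mul_apply] <;>
          first | linear_combination hab | ring
      i_mul_j := by
        ext i j
        fin_cases i <;> fin_cases j <;> simp [Matrix.mul_apply]
      j_mul_i := by
        ext i j
        fin_cases i <;> fin_cases j <;> simp [Matrix.mul_apply] }
  refine nonempty_tensor_quaternion_algEquiv (by simp [Module.finrank_matrix]) q fun t => ?_
  refine ⟨(t 0 0 + t 1 1) / 2, (t 1 0 - t 0 1) / 2,
    -(a * ((t 0 0 - t 1 1) / 2) + b * ((t 0 1 + t 1 0) / 2)),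
    -(a * ((t 0 1 + t 1 0) / 2) - b * ((t 0 0 - t 1 1) / 2)), ?_⟩
  ext i j
  fin_cases i <;> fin_cases j <;> simp [q]
  · linear_combination ((t 0 0 - t 1 1) / 2) * hab
  · linear_combination ((t 0 1 + t 1 0) / 2) * hab
  · linear_combination ((t 0 1 + t 1 0) / 2) * hab
  · linear_combination (-(t 0 0 - t 1 1) / 2) * hab

/-- `(-1, -1)` splits over `ℚ(C₄)`, because `-1 = (x²)² + (y²)²` there. -/
theorem ratHamiltonClass_mem_relBrauer : ratHamiltonClass ∈ relBrauer ℚ := by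
  obtain ⟨φ⟩ := nonempty_tensor_quaternion_algEquiv_matrix (F := FunField ℚ)
    (a := fx ℚ ^ 2) (b := fy ℚ ^ 2) (by linear_combination fy_pow ℚ)
  exact ⟨_, _, rfl, rfl, 1, 1 * 2, one_ne_zero, two_ne_zero, ⟨(φ.mapMatrix.trans
    (Matrix.compAlgEquiv (Fin 1) (Fin 2) (FunField ℚ) (FunField ℚ))).trans
    (Matrix.reindexAlgEquiv (FunField ℚ) (FunField ℚ) finProdFinEquiv)⟩⟩

end Hamilton

/-! ### The crossed product algebra -/

section CrossedProduct

variable {L : Type} [Field L] [Algebra ℚ L] [FiniteDimensional ℚ L]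
  {a a' : (L ≃ₐ[ℚ] L) → (L ≃ₐ[ℚ] L) → Lˣ}

/-- Multiplication of a crossed product algebra in terms of coordinates. -/
def crossedMul (a : (L ≃ₐ[ℚ] L) → (L ≃ₐ[ℚ] L) → Lˣ) (x y : (L ≃ₐ[ℚ] L) → L) :
    (L ≃ₐ[ℚ] L) → L :=
  open Classical in ∑ σ, ∑ τ, Pi.single (σ * τ) (x σ * σ (y τ) * a σ τ)

/-- The map from coordinates to a crossed product algebra. -/
def crossedMap {A : Type*} [Ring A] [Algebra ℚ A] (ι : L →ₐ[ℚ] A) (e : (L ≃ₐ[ℚ] L) → A) :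
    ((L ≃ₐ[ℚ] L) → L) →ₗ[ℚ] A where
  toFun c := ∑ σ, ι (c σ) * e σ
  map_add' c d := by simp [add_mul, Finset.sum_add_distrib]
  map_smul' r c := by simp [Finset.smul_sum]

open Classical in
theorem crossedMap_single {A : Type*} [Ring A] [Algebra ℚ A] (ι : L →ₐ[ℚ] A)
    (e : (L ≃ₐ[ℚ] L) → A) (σ : L ≃ₐ[ℚ] L) (c : L) :
    crossedMap ι e (Pi.single σ c) = ι c * e σ := by
  change ∑ τ, ι ((Pi.single σ c : (L ≃ₐ[ℚ] L) → L) τ) * e τ = _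
  rw [Finset.sum_eq_single σ]
  · simp
  · intro τ _ h
    simp [Pi.single_eq_of_ne h]
  · simp

theorem crossedMap_mul {A : Type*} [Ring A] [Algebra ℚ A] {ι : L →ₐ[ℚ] A} {e : (L ≃ₐ[ℚ] L) → A}
    (h1 : ∀ σ c, e σ * ι c = ι (σ c) * e σ) (h2 : ∀ σ τ, e σ * e τ = ι (a σ τ) * e (σ * τ))
    (x y : (L ≃ₐ[ℚ] L) → L) :
    crossedMap ι e x * crossedMap ι e y = crossedMap ι e (crossedMul a x y) := by
  classical
  simp only [crossedMul, map_sum, crossedMap_single]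
  change (∑ σ, ι (x σ) * e σ) * (∑ σ, ι (y σ) * e σ) = _
  rw [Finset.sum_mul_sum]
  refine Finset.sum_congr rfl fun σ _ => Finset.sum_congr rfl fun τ _ => ?_
  rw [map_mul, map_mul, mul_assoc (ι (x σ)), ← mul_assoc (e σ), h1, mul_assoc (ι (σ (y τ))), h2]
  simp only [mul_assoc]

/-- A crossed product algebra is determined by the cocycle. -/
theorem IsCrossedProduct.nonempty_algEquiv {A B : Type} [Ring A] [Algebra ℚ A] [Ring B]
    [Algebra ℚ B] (hA : IsCrossedProduct a A) (hB : IsCrossedProduct a B) :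
    Nonempty (A ≃ₐ[ℚ] B) := by
  obtain ⟨ι, e, h1, h2, h3⟩ := hA
  obtain ⟨ι', e', h1', h2', h3'⟩ := hB
  let Ψ := LinearEquiv.ofBijective (crossedMap ι e) h3
  let Ψ' := LinearEquiv.ofBijective (crossedMap ι' e') h3'
  let θ : A ≃ₗ[ℚ] B := Ψ.symm.trans Ψ'
  have hmul : ∀ x y, θ (x * y) = θ x * θ y := fun x y => by
    obtain ⟨x, rfl⟩ := Ψ.surjective x
    obtain ⟨y, rfl⟩ := Ψ.surjective y
    have e1 : Ψ x * Ψ y = Ψ (crossedMul a x y) := crossedMap_mul h1 h2 x y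
    have e2 : Ψ' x * Ψ' y = Ψ' (crossedMul a x y) := crossedMap_mul h1' h2' x y
    rw [e1]
    simp only [θ, LinearEquiv.trans_apply, LinearEquiv.symm_apply_apply, e2]
  have hone : θ 1 = 1 := by
    obtain ⟨x, hx⟩ := θ.surjective 1
    rw [← mul_one (θ 1), ← hx, ← hmul, one_mul]
  exact ⟨AlgEquiv.ofLinearEquiv θ hone hmul⟩

/-- Cohomologous cocycles have the same crossed product algebras. -/
theorem IsCrossedProduct.of_cohomologous {A : Type} [Ring A] [Algebra ℚ A]
    (hA : IsCrossedProduct a' A) (k : (L ≃ₐ[ℚ] L) → L) (hk : ∀ σ, k σ ≠ 0)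
    (h : ∀ σ τ, (a' σ τ : L) * k (σ * τ) = a σ τ * (k σ * σ (k τ))) : IsCrossedProduct a A := by
  obtain ⟨ι, e, h1, h2, h3⟩ := hA
  refine ⟨ι, fun σ => ι (k σ)⁻¹ * e σ, fun σ c => ?_, fun σ τ => ?_, ?_⟩
  · rw [mul_assoc, h1, ← mul_assoc, ← mul_assoc, ← map_mul, ← map_mul, mul_comm]
  · have : (k σ)⁻¹ * (σ (k τ)⁻¹ * a' σ τ) = a σ τ * (k (σ * τ))⁻¹ := by
      have e1 := hk σ
      have e2 := hk (σ * τ)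
      have e3 : σ (k τ) ≠ 0 := by simpa using hk τ
      rw [map_inv₀]
      field_simp
      linear_combination h σ τ
    rw [mul_assoc, ← mul_assoc (e σ), h1, mul_assoc (ι (σ (k τ)⁻¹)), h2, ← mul_assoc, ← mul_assoc,
      ← mul_assoc, ← map_mul, ← map_mul, mul_assoc (k σ)⁻¹, this, map_mul]
  · have hb : Function.Bijective fun (c : (L ≃ₐ[ℚ] L) → L) σ => c σ * (k σ)⁻¹ := by
      refine ⟨fun c d hcd => funext fun σ => ?_, fun c => ⟨fun σ => c σ * k σ, funext fun σ => ?_⟩⟩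
      · exact mul_right_cancel₀ (inv_ne_zero (hk σ)) (congrFun hcd σ)
      · exact mul_inv_cancel_right₀ (hk σ) _
    convert h3.comp hb using 1
    ext c
    simp only [Function.comp_apply, map_mul, mul_assoc]

end CrossedProduct

section Explicit

theorem matrix_add_fin_two {R : Type*} [Add R] (a b c d a' b' c' d' : R) :
    !![a, b; c, d] + !![a', b'; c', d'] = !![a + a', b + b'; c + c', d + d'] := by
  refine Matrix.ext fun i j => ?_
  fin_cases i <;> fin_cases j <;> rfl

theorem matrix_sub_fin_two {R : Type*} [Sub R] (a b c d a' b' c' d' : R) :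
    !![a, b; c, d] - !![a', b'; c', d'] = !![a - a', b - b'; c - c', d - d'] := by
  refine Matrix.ext fun i j => ?_
  fin_cases i <;> fin_cases j <;> rfl

/-- The image of `ζ₈` in the crossed product algebra. -/
def matZeta : Matrix (Fin 2) (Fin 2) ℍ[ℚ] := !![0, quat 1 1 0 0; quat (1/2) (1/2) 0 0, 0]

/-- The basis element `e_σ` of the crossed product algebra, for `σ ζ₈ = ζ₈³`. -/
def matThree : Matrix (Fin 2) (Fin 2) ℍ[ℚ] := !![quat 0 0 1 0, 0; 0, quat 0 0 (-1) 0]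

/-- The basis element `e_σ` of the crossed product algebra, for `σ ζ₈ = ζ₈⁵`. -/
def matFive : Matrix (Fin 2) (Fin 2) ℍ[ℚ] := !![1, 0; 0, -1]

/-- The basis element `e_σ` of the crossed product algebra, for `σ ζ₈ = ζ₈⁷`. -/
def matSeven : Matrix (Fin 2) (Fin 2) ℍ[ℚ] := !![quat 0 0 1 0, 0; 0, quat 0 0 1 0]

theorem matZeta_sq : matZeta ^ 2 = !![quat 0 1 0 0, 0; 0, quat 0 1 0 0] := by
  rw [pow_two, matZeta, Matrix.mul_fin_two]
  simp [quat_mul, quat_zero, quat_add]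
  norm_num

theorem matZeta_pow_four : matZeta ^ 4 = -1 := by
  rw [show 4 = 2 * 2 by rfl, pow_mul, matZeta_sq, pow_two, Matrix.mul_fin_two, Matrix.one_fin_two]
  simp [quat_mul, quat_zero, quat_add, quat_one, quat_neg]

theorem matThree_mul : matThree * matZeta = matZeta ^ 3 * matThree := by
  rw [pow_succ, matZeta_sq]
  simp [matThree, matZeta, quat_mul, quat_zero, quat_add]

theorem matFive_mul : matFive * matZeta = matZeta ^ 5 * matFive := by
  rw [pow_succ, matZeta_pow_four]
  simp [matFive, matZeta, quat_mul, quat_zero, quat_add, quat_one, quat_neg]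

theorem matSeven_mul : matSeven * matZeta = matZeta ^ 7 * matSeven := by
  rw [show 7 = 4 + 2 + 1 by rfl, pow_succ, pow_add, matZeta_pow_four, matZeta_sq]
  simp [matSeven, matZeta, quat_mul, quat_zero, quat_add, quat_neg]

theorem matThree_mul_matThree : matThree * matThree = -1 := by
  rw [matThree, Matrix.mul_fin_two, Matrix.one_fin_two]
  simp [quat_mul, quat_zero, quat_add, quat_one, quat_neg]

theorem matThree_mul_matFive : matThree * matFive = matSeven := by
  rw [matThree, matFive, matSeven, Matrix.mul_fin_two]
  simp [quat_mul, quat_zero, quat_add, quat_one, quat_neg]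

theorem matFive_mul_matThree : matFive * matThree = matSeven := by
  rw [matThree, matFive, matSeven, Matrix.mul_fin_two]
  simp [quat_mul, quat_zero, quat_add, quat_one, quat_neg]

theorem matFive_mul_matFive : matFive * matFive = 1 := by
  rw [matFive, Matrix.mul_fin_two, Matrix.one_fin_two]
  simp

theorem matThree_mul_matSeven : matThree * matSeven = -matFive := by
  rw [← matThree_mul_matFive, ← mul_assoc, matThree_mul_matThree, neg_one_mul]

theorem matFive_mul_matSeven : matFive * matSeven = matThree := by
  rw [← matFive_mul_matThree, ← mul_assoc, matFive_mul_matFive, one_mul]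

theorem matSeven_mul_matThree : matSeven * matThree = -matFive := by
  rw [← matFive_mul_matThree, mul_assoc, matThree_mul_matThree, mul_neg_one]

theorem matSeven_mul_matFive : matSeven * matFive = matThree := by
  rw [← matThree_mul_matFive, mul_assoc, matFive_mul_matFive, mul_one]

theorem matSeven_mul_matSeven : matSeven * matSeven = -1 := by
  nth_rw 1 [← matFive_mul_matThree]
  rw [mul_assoc, matThree_mul_matSeven, mul_neg, matFive_mul_matFive]

theorem finrank_eq_four (L : Type*) [Field L] [Algebra ℚ L] [IsCyclotomicExtension {8} ℚ L] :
    Module.finrank ℚ L = 4 := by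
  rw [IsCyclotomicExtension.finrank L (cyclotomic.irreducible_rat (n := 8) (by norm_num))]
  decide

/-- The minimal polynomial of `ζ₈` is `X⁴ + 1`. -/
theorem exists_algHom_apply_eq {L : Type*} [Field L] [Algebra ℚ L]
    [IsCyclotomicExtension {8} ℚ L] {ζ : L} (hζ : IsPrimitiveRoot ζ 8)
    {S : Type*} [Ring S] [Algebra ℚ S] {z : S} (hz : z ^ 4 = -1) :
    ∃ φ : L →ₐ[ℚ] S, φ ζ = z := by
  have h1 : minpoly ℚ ζ = X ^ 4 + 1 := by
    have h := hζ.minpoly_eq_cyclotomic_of_irreducible (K := ℚ)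
      (cyclotomic.irreducible_rat (by norm_num))
    rw [← h, show 8 = 2 ^ (2 + 1) by rfl, cyclotomic_prime_pow_eq_geom_sum Nat.prime_two]
    simp [Finset.sum_range_succ, add_comm]
  have h2 : aeval z (minpoly ℚ (hζ.powerBasis ℚ).gen) = 0 := by
    rw [hζ.powerBasis_gen ℚ, h1]
    simp [hz]
  exact ⟨(hζ.powerBasis ℚ).lift z h2,
    (congrArg _ (hζ.powerBasis_gen ℚ).symm).trans (PowerBasis.lift_gen ..)⟩

theorem exists_algEquiv_apply_eq {L : Type*} [Field L] [Algebra ℚ L]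
    [IsCyclotomicExtension {8} ℚ L] {ζ : L} (hζ : IsPrimitiveRoot ζ 8)
    {z : L} (hz : z ^ 4 = -1) : ∃ σ : L ≃ₐ[ℚ] L, σ ζ = z := by
  have : FiniteDimensional ℚ L := IsCyclotomicExtension.finiteDimensional {8} ℚ L
  obtain ⟨φ, hφ⟩ := exists_algHom_apply_eq hζ hz
  exact ⟨AlgEquiv.ofBijective φ φ.bijective, hφ⟩

theorem mul_algHom_eq {L : Type*} [Field L] [Algebra ℚ L]
    [IsCyclotomicExtension {8} ℚ L] {ζ : L} (hζ : IsPrimitiveRoot ζ 8)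
    {A : Type*} [Ring A] [Algebra ℚ A] {ι : L →ₐ[ℚ] A} {e : A}
    {σ : L ≃ₐ[ℚ] L} (h : e * ι ζ = ι (σ ζ) * e) (c : L) : e * ι c = ι (σ c) * e := by
  have hc : c ∈ Algebra.adjoin ℚ {ζ} := by
    rw [IsCyclotomicExtension.adjoin_primitive_root_eq_top hζ]; trivial
  induction hc using Algebra.adjoin_induction with
  | mem x hx => rwa [Set.mem_singleton_iff.1 hx]
  | algebraMap r => rw [AlgEquiv.commutes, AlgHom.commutes, Algebra.commutes]
  | add x y _ _ hx hy => simp [mul_add, add_mul, hx, hy]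
  | mul x y _ _ hx hy => rw [map_mul, ← mul_assoc, hx, mul_assoc, hy, map_mul, map_mul, mul_assoc]

/-- The matrix ring `M₂(ℍ)` over the rational quaternions is the crossed product algebra of the
cocycle of `E`. -/
theorem isCrossedProduct_matrix {L : Type} [Field L] [CharZero L] [Algebra ℚ L]
    [FiniteDimensional ℚ L] [IsCyclotomicExtension {8} ℚ L] {ζ : L} (hζ : IsPrimitiveRoot ζ 8) :
    IsCrossedProduct (cocycleSign ζ) (Matrix (Fin 2) (Fin 2) ℍ[ℚ]) := by
  have h4 := pow_four_of_isPrimitiveRoot hζ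
  obtain ⟨ι, hι⟩ := exists_algHom_apply_eq hζ matZeta_pow_four
  let e : (L ≃ₐ[ℚ] L) → Matrix (Fin 2) (Fin 2) ℍ[ℚ] := fun σ =>
    selectOdd ζ (σ ζ) 1 matThree matFive matSeven
  have hcases : ∀ σ : L ≃ₐ[ℚ] L, σ ζ = ζ ∨ σ ζ = ζ ^ 3 ∨ σ ζ = ζ ^ 5 ∨ σ ζ = ζ ^ 7 := fun σ =>
    eq_or_eq_of_pow_four h4 (by rw [← map_pow, h4]; simp)
  have e1 : ∀ {σ : L ≃ₐ[ℚ] L}, σ ζ = ζ → e σ = 1 := fun h => by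
    simp only [e, h, selectOdd_one]
  have e3 : ∀ {σ : L ≃ₐ[ℚ] L}, σ ζ = ζ ^ 3 → e σ = matThree := fun h => by
    simp only [e, h, selectOdd_three hζ]
  have e5 : ∀ {σ : L ≃ₐ[ℚ] L}, σ ζ = ζ ^ 5 → e σ = matFive := fun h => by
    simp only [e, h, selectOdd_five hζ]
  have e7 : ∀ {σ : L ≃ₐ[ℚ] L}, σ ζ = ζ ^ 7 → e σ = matSeven := fun h => by
    simp only [e, h, selectOdd_seven hζ]
  refine ⟨ι, e, fun σ => mul_algHom_eq hζ ?_, fun σ τ => ?_, ?_⟩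
  · rcases hcases σ with h | h | h | h
    · rw [e1 h, h, one_mul, mul_one]
    · rw [e3 h, h, map_pow, hι, matThree_mul]
    · rw [e5 h, h, map_pow, hι, matFive_mul]
    · rw [e7 h, h, map_pow, hι, matSeven_mul]
  · have red : ∀ k, ζ ^ k = ζ ^ (k % 8) := fun k => pow_eq_pow_mod k hζ.pow_eq_one
    have p2 : ζ ^ 6 ≠ ζ ^ 2 := fun h =>
      absurd (hζ.pow_inj (by norm_num : 6 < 8) (by norm_num : 2 < 8) h) (by norm_num)
    have hστ : (σ * τ) ζ = σ (τ ζ) := rfl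
    simp only [e, hστ, cocycleSign]
    rcases hcases σ with h | h | h | h <;> rcases hcases τ with h' | h' | h' | h' <;>
      simp [h, h', map_pow, ← pow_mul, red 9, red 15, red 21, red 25, red 35, red 49, red 14,
        red 10, selectOdd_one, selectOdd_three hζ, selectOdd_five hζ, selectOdd_seven hζ, p2,
        matThree_mul_matThree, matThree_mul_matFive, matThree_mul_matSeven, matFive_mul_matThree,
        matFive_mul_matFive, matFive_mul_matSeven, matSeven_mul_matThree, matSeven_mul_matFive,
        matSeven_mul_matSeven]
  · have hs : Function.Surjective (crossedMap ι e) := by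
      classical
      obtain ⟨σ3, h3⟩ := exists_algEquiv_apply_eq hζ (pow_odd_pow_four h4 1)
      obtain ⟨σ5, h5⟩ := exists_algEquiv_apply_eq hζ (pow_odd_pow_four h4 2)
      obtain ⟨σ7, h7⟩ := exists_algEquiv_apply_eq hζ (pow_odd_pow_four h4 3)
      intro M
      -- `s = √2`, and `c p q = p + q √-1`
      let s : L := ζ - ζ ^ 3
      let c : ℚ → ℚ → L := fun p q => p • (1 : L) + q • ζ ^ 2
      have hs : ι s = !![0, quat 2 0 0 0; quat 1 0 0 0, 0] := by
        rw [map_sub, map_pow, hι, pow_succ, matZeta_sq, matZeta, Matrix.mul_fin_two,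
          matrix_sub_fin_two]
        simp only [quat_mul, quat_zero, quat_add, quat_sub]
        congr <;> norm_num
      have hc : ∀ p q, ι (c p q) = !![quat p q 0 0, 0; 0, quat p q 0 0] := fun p q => by
        simp only [c, map_add, map_smul, map_one, map_pow, hι, matZeta_sq, Matrix.one_fin_two]
        simp [quat_one, quat_zero, quat_add, quat_smul]
      -- the coordinates of `M`, from those of its entries: `s` swaps the two diagonals, and the
      -- sign of `matFive` separates the entries on a diagonal
      refine ⟨
        Pi.single 1 (c (((M 0 0).re + (M 1 1).re) / 2) (((M 0 0).imI + (M 1 1).imI) / 2) +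
          s * c ((M 1 0).re / 2 + (M 0 1).re / 4) ((M 1 0).imI / 2 + (M 0 1).imI / 4)) +
        Pi.single σ5 (c (((M 0 0).re - (M 1 1).re) / 2) (((M 0 0).imI - (M 1 1).imI) / 2) +
          s * c ((M 1 0).re / 2 - (M 0 1).re / 4) ((M 1 0).imI / 2 - (M 0 1).imI / 4)) +
        Pi.single σ7 (c (((M 0 0).imJ + (M 1 1).imJ) / 2) (((M 0 0).imK + (M 1 1).imK) / 2) +
          s * c ((M 1 0).imJ / 2 + (M 0 1).imJ / 4) ((M 1 0).imK / 2 + (M 0 1).imK / 4)) +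
        Pi.single σ3 (c (((M 0 0).imJ - (M 1 1).imJ) / 2) (((M 0 0).imK - (M 1 1).imK) / 2) +
          s * c ((M 1 0).imJ / 2 - (M 0 1).imJ / 4) ((M 1 0).imK / 2 - (M 0 1).imK / 4)), ?_⟩
      have hM : M = !![quat (M 0 0).re (M 0 0).imI (M 0 0).imJ (M 0 0).imK,
          quat (M 0 1).re (M 0 1).imI (M 0 1).imJ (M 0 1).imK;
          quat (M 1 0).re (M 1 0).imI (M 1 0).imJ (M 1 0).imK,
          quat (M 1 1).re (M 1 1).imI (M 1 1).imJ (M 1 1).imK] := Matrix.eta_fin_two M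
      simp only [map_add, crossedMap_single, e1 (AlgEquiv.one_apply ζ), e3 h3, e5 h5, e7 h7,
        map_mul, hs, hc, matThree, matFive, matSeven, mul_one]
      conv_rhs => rw [hM]
      simp only [Matrix.mul_fin_two, quat_mul, quat_zero, quat_one, quat_neg,
        quat_add, matrix_add_fin_two]
      congr <;> ring
    refine ⟨(LinearMap.injective_iff_surjective_of_finrank_eq_finrank ?_).2 hs, hs⟩
    have : IsGalois ℚ L := IsCyclotomicExtension.isGalois {8} ℚ L
    have hcard : Fintype.card (L ≃ₐ[ℚ] L) = 4 := by
      rw [← Nat.card_eq_fintype_card, IsGalois.card_aut_eq_finrank, finrank_eq_four]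
    rw [Module.finrank_pi_fintype, Module.finrank_matrix, Quaternion.finrank_eq_four]
    simp [finrank_eq_four L, hcard]

end Explicit

/-! ### The image in the Brauer group -/

section Image

variable {L : Type} [Field L] [CharZero L] [Algebra ℚ L]

/-- Linearly equivalent divisors give cohomologous cocycles, whatever the functions `u_σ`. -/
theorem exists_cohomologous {w : L} (hw : w ^ 4 = -1) {D D' : Divisor L} (h : cls D' = cls D)
    {u u' : (L ≃ₐ[ℚ] L) → FunField L} {a a' : (L ≃ₐ[ℚ] L) → (L ≃ₐ[ℚ] L) → Lˣ}
    (hu : ∀ σ, IsDiv (u σ) (D - galDiv σ D)) (hu' : ∀ σ, IsDiv (u' σ) (D' - galDiv σ D'))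
    (ha : ∀ σ τ, u σ * galFun σ (u τ) = algebraMap L (FunField L) (a σ τ) * u (σ * τ))
    (ha' : ∀ σ τ, u' σ * galFun σ (u' τ) = algebraMap L (FunField L) (a' σ τ) * u' (σ * τ)) :
    ∃ k : (L ≃ₐ[ℚ] L) → L, (∀ σ, k σ ≠ 0) ∧
      ∀ σ τ, (a' σ τ : L) * k (σ * τ) = a σ τ * (k σ * σ (k τ)) := by
  obtain ⟨f, hf⟩ := cls_eq_iff.1 h
  -- `u'_σ` and `u_σ · f / σ f` have the same divisor
  have hk : ∀ σ, ∃ c : L, c ≠ 0 ∧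
      u' σ = algebraMap L (FunField L) c * (u σ * (f / galFun σ f)) := fun σ => by
    refine (hu' σ).exists_eq_const_mul hw ?_
    convert (hu σ).mul (hf.div (hf.gal σ)) using 1
    rw [map_sub]
    abel
  choose k hk0 hk using hk
  refine ⟨k, hk0, fun σ τ => (algebraMap L (FunField L)).injective ?_⟩
  have h1 := ha' σ τ
  have h2 := ha σ τ
  have nf := hf.1
  have nσ := (hf.gal σ).1
  have nστ := (hf.gal (σ * τ)).1
  have nu := (hu (σ * τ)).1
  rw [hk σ, hk τ, hk (σ * τ), map_mul, map_mul, map_div₀, galFun_const, galFun_mul] at h1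
  rw [galFun_mul] at nστ
  simp only [map_mul]
  field_simp at h1
  refine mul_right_cancel₀ nu ?_
  linear_combination
    -h1 + algebraMap L (FunField L) (k σ) * algebraMap L (FunField L) (σ (k τ)) * h2

end Image

/-- The class of `M₂((-1, -1))` is that of `(-1, -1)`. -/
theorem mk_matrix_eq_ratHamiltonClass : (Quotient.mk (Brauer.CSA_Setoid ℚ)
    { AlgCat.of ℚ (Matrix (Fin 2) (Fin 2) ℍ[ℚ]) with } : BrauerGroup.{0, 0} ℚ) =
      ratHamiltonClass :=
  Quotient.sound ⟨1, 1 * 2, one_ne_zero, two_ne_zero,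
    ⟨(Matrix.compAlgEquiv (Fin 1) (Fin 2) ℍ[ℚ] ℚ).trans
      (Matrix.reindexAlgEquiv ℚ ℍ[ℚ] finProdFinEquiv)⟩⟩

theorem hasBrauerImage_divE_iff {L : Type} [Field L] [CharZero L] [Algebra ℚ L]
    [FiniteDimensional ℚ L] [IsCyclotomicExtension {8} ℚ L] {ζ : L} (hζ : IsPrimitiveRoot ζ 8)
    (γ : BrauerGroup.{0, 0} ℚ) : HasBrauerImage (cls (divE ζ)) γ ↔ γ = ratHamiltonClass := by
  have hA := isCrossedProduct_matrix hζ
  have hu := isDiv_uFun (K := L) hζ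
  rw [← mk_matrix_eq_ratHamiltonClass]
  constructor
  · rintro ⟨D, u', a', B, hD, hu', ha', hB, rfl⟩
    obtain ⟨k, hk0, hk⟩ := exists_cohomologous (pow_four_of_isPrimitiveRoot hζ) hD hu hu'
      (uFun_mul hζ) fun σ τ => by rw [ha', div_mul_cancel₀ _ (hu' _).1]
    obtain ⟨φ⟩ := (hB.of_cohomologous k hk0 hk).nonempty_algEquiv hA
    exact Quotient.sound ⟨1, 1, one_ne_zero, one_ne_zero, ⟨φ.mapMatrix⟩⟩
  · rintro rfl
    exact ⟨divE ζ, fun σ => uFun ζ (σ ζ), cocycleSign ζ, _, rfl, hu, fun σ τ => by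
      rw [uFun_mul hζ, mul_div_cancel_right₀ _ (hu _).1], hA, rfl⟩

end FermatTwist

end

open FermatTwist in
theorem proposition4p3
    (L : Type) [Field L] [NumberField L] [IsCyclotomicExtension {8} ℚ L]
    (ζ : L) (hζ : IsPrimitiveRoot ζ 8) :
    (cls (divE ζ) ∈ Pic0 L ∧ ∀ σ : L ≃ₐ[ℚ] L, cls (galDiv σ (divE ζ)) = cls (divE ζ)) ∧
    (∀ (M : Type) [Field M] [CharZero M] [Algebra ℚ M] [IsGalois ℚ M] (ξ : M),
      IsPrimitiveRoot ξ 8 →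
      ¬ ∃ D : Divisor M, DefinedOverRat D ∧ cls (divE ξ) = cls D) ∧
    (∃ β : BrauerGroup.{0, 0} ℚ,
      (∀ γ, HasBrauerImage (cls (divE ζ)) γ ↔ γ = β) ∧
      β ∈ relBrauer ℚ ∧ β ≠ brauerOne ℚ ∧
      BaseChangesTo (K' := ℝ) β hamiltonClass ∧ hamiltonClass ≠ brauerOne ℝ) := by
  refine ⟨⟨⟨divE ζ, degree_divE (pow_four_of_isPrimitiveRoot hζ), rfl⟩, fun σ =>
    (cls_eq_iff.2 ⟨_, isDiv_uFun hζ σ⟩).symm⟩, ?_, ratHamiltonClass, hasBrauerImage_divE_iff hζ,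
    ratHamiltonClass_mem_relBrauer, ratHamiltonClass_ne_one, baseChangesTo_hamiltonClass,
    hamiltonClass_ne_one⟩
  rintro M _ _ _ _ ξ hξ ⟨D, hD, h⟩
  exact not_cls_divE_eq_cls hξ hD h
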